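/- **Setting.** Let $q\ge 1$ be an integer and let $G=(V,E)$ be a $(q+1)$-regular undirected graph, finite or infinite, with multiple edges and multiple loops allowed. Every edge (loops included) gives two distinct directed edges $e$ and $\bar e$, inverse to each other; $e$ has an origin and a terminus, and $(q+1)$-regular means that every vertex is the origin of exactly $q+1$ directed edges. A walk of length $r$ from $a$ to $b$ is a sequence of directed edges $e_0,\dots,e_{r-1}$, each starting where the preceding one ends, that leads from $a$ to $b$ (for $r=0$: the trivial walk, $a=b$). It is non-backtracking if $e_i\ne\overline{e_{i+1}}$ for all $0\le i\le r-2$. Let $A$ be the adjacency operator on $\ell^2(V)$, whose matrix entry $A_{ab}$ is the number of directed edges from $a$ to $b$, and let $A_r$ be the operator on $\ell^2(V)$ whose matrix entry $(A_r)_{ab}$ is the number of non-backtracking walks of length $r$ from $a$ to $b$. The polynomials $X_{r,q}$ are defined by $$\frac{1-q^{-1}t^2}{1-xt+t^2}=\sum_{r=0}^\infty X_{r,q}(x)\,t^r .$$ Let $\mu_q$ be the Kesten–McKay distribution, given by $$d\mu_q(x)=\frac1{2\pi}\,\frac{(q+1)\sqrt{4-x^2}}{(q^{-1/2}+q^{1/2})^2-x^2}\,\mathbf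 1_{|x|\le 2}\,dx .$$ For $\rho>1$ let $$\Omega(\rho)=\left\{w\in\mathbb C:\frac{(\operatorname{Re}w)^2}{(\rho+\rho^{-1})^2}+\frac{(\operatorname{Im}w)^2}{(\rho-\rho^{-1})^2}<1\right\}.$$ **Theorem.** (0) $\mu_q$ is the normalized spectral measure of the $(q+1)$-regular tree $\mathbb T_q$: it is a probability measure, and $\int P\,d\mu_q=\langle \mathbf 1_o,P(q^{-1/2}A(\mathbb T_q))\mathbf 1_o\rangle$ for every real polynomial $P$ and every vertex $o$ of $\mathbb T_q$. (1) The matrices above define bounded operators $A$ and $A_r$ $(r\ge 0)$ on $\ell^2(V)$, and $A$ is self-adjoint. Let $\rho>q^{1/2}$ and let $h$ be holomorphic on $\Omega(\rho)$. Then the spectrum of $q^{-1/2}A$ is contained in $\Omega(\rho)$, the functions $h$ and $hX_{r,q}$ $(r\ge0)$ are $\mu_q$-integrable, and $$h(q^{-1/2}A)=\left(\int_{\mathbb R} h\,d\mu_q\right) I+\sum_{r=1}^\infty q^{-r/2}\,a_{r,q}(h)\,A_r ,\qquad a_{r,q}(h)=(1+q^{-1})^{-1}\int_{-2}^{2}h(x)X_{r,q}(x)\,d\mu_q(x),$$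 where the series converges (unconditionally) in operator norm. -/

import Mathlib

noncomputable section

/-- An undirected graph with vertex set `V`, multiple edges and multiple loops allowed, given by
its set `D` of directed edges: every (undirected) edge, loops included, gives rise to two distinct
directed edges `e` and `inv e`, and `D` is the set of all of them. Neither `V` nor `D` need be
finite. -/
structure MultiGraph (V : Type*) (D : Type*) where
  /-- the origin of a directed edge -/
  org : D → V
  /-- the terminus of a directed edge -/
  tgt : D → V
  /-- the inverse of a directed edge -/
  inv : D → D
  inv_inv : ∀ e, inv (inv e) = e
  inv_ne : ∀ e, inv e ≠ e
  org_inv : ∀ e, org (inv e) = tgt e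

namespace MultiGraph

variable {V D : Type*} (G : MultiGraph V D)

/-- Every vertex has degree `d` (a loop contributes two to the degree of its vertex). For `d ≠ 0`
this entails that every vertex has finitely many incident edges. -/
def IsRegular (d : ℕ) : Prop := ∀ v : V, Nat.card {e : D // G.org e = v} = d

/-- The entries of the adjacency matrix: the number of directed edges from `a` to `b`. -/
def adjEntry (a b : V) : ℕ := Nat.card {e : D // G.org e = a ∧ G.tgt e = b}

/-- Non-backtracking walks of length `n` from `a` to `b`: vertices `v 0, …, v n` and directed edges
`e 0, …, e (n - 1)` such that `e i` goes from `v i` to `v (i + 1)`, `v 0 = a`, `v n = b`, and `e i`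
is never the inverse of `e (i + 1)`. -/
@[ext]
structure NBWalk (n : ℕ) (a b : V) where
  vert : Fin (n + 1) → V
  edge : Fin n → D
  org_edge : ∀ i, G.org (edge i) = vert i.castSucc
  tgt_edge : ∀ i, G.tgt (edge i) = vert i.succ
  vert_zero : vert 0 = a
  vert_last : vert (Fin.last n) = b
  nonbacktracking : ∀ i j : Fin n, (j : ℕ) = i + 1 → edge i ≠ G.inv (edge j)

/-- The entries of the non-backtracking matrix of length `n`: the number of non-backtracking walks
of length `n` from `a` to `b`. -/
def nbEntry (n : ℕ) (a b : V) : ℕ := Nat.card (G.NBWalk n a b)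

/-- A tree: a non-empty connected graph without non-trivial closed non-backtracking walks. -/
structure IsTree : Prop where
  nonempty : Nonempty V
  connected : ∀ a b : V, Relation.ReflTransGen (fun x y => ∃ e, G.org e = x ∧ G.tgt e = y) a b
  acyclic : ∀ (n : ℕ) (a : V), 1 ≤ n → IsEmpty (G.NBWalk n a a)

end MultiGraph

/-- The Hilbert space `ℓ²(V)` of square summable complex functions on `V`. -/
abbrev L2 (V : Type*) : Type _ := lp (fun _ : V => ℂ) 2

open Classical in
/-- The indicator function of the vertex `v`, as an element of `ℓ²(V)`. -/
def indicatorL2 {V : Type*} (v : V) : L2 V := lp.single 2 v (1 : ℂ)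

/-- The bounded operator `T` on `ℓ²(V)` has the matrix `M`, that is, `M a b` is the value at `a` of
the image under `T` of the indicator function of `b`. -/
def HasMatrix {V : Type*} (T : L2 V →L[ℂ] L2 V) (M : V → V → ℕ) : Prop :=
  ∀ a b : V, T (indicatorL2 b) a = (M a b : ℂ)

/-- A bounded operator on `ℓ²(V)` is determined by its matrix. -/
theorem HasMatrix.unique {V : Type*} {T S : L2 V →L[ℂ] L2 V} {M : V → V → ℕ}
    (hT : HasMatrix T M) (hS : HasMatrix S M) : T = S := by
  classical
  have key : ∀ (b : V) (c : ℂ), T (lp.single 2 b c) = S (lp.single 2 b c) := by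
    intro b c
    have h1 : T (indicatorL2 b) = S (indicatorL2 b) := by
      ext a
      rw [hT a b, hS a b]
    have h2 : (lp.single 2 b c : L2 V) = c • indicatorL2 b := by
      unfold indicatorL2
      rw [← lp.single_smul]
      ext a
      by_cases h : a = b
      · subst h
        simp
      · simp [h]
    rw [h2, map_smul, map_smul, h1]
  ext1 f
  have hf : HasSum (fun b => (lp.single 2 b (f b) : L2 V)) f :=
    lp.hasSum_single (by simp) f
  have h1 := hf.mapL T
  have h2 := hf.mapL S
  simp only [key] at h1
  exact h1.unique h2

open Classical in
/-- The bounded operator on `ℓ²(V)` with the matrix `M` (and `0` if there is no such operator). -/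
def opOfMatrix {V : Type*} (M : V → V → ℕ) : L2 V →L[ℂ] L2 V :=
  if h : ∃ T : L2 V →L[ℂ] L2 V, HasMatrix T M then h.choose else 0

namespace MultiGraph

variable {V D : Type*} (G : MultiGraph V D)

/-- The adjacency operator `A` on `ℓ²(V)`. -/
def adjOp : L2 V →L[ℂ] L2 V := opOfMatrix G.adjEntry

/-- The operator `A_r` on `ℓ²(V)` given by the non-backtracking matrix of length `r`. -/
def nbOp (r : ℕ) : L2 V →L[ℂ] L2 V := opOfMatrix (G.nbEntry r)

/-- The normalized adjacency operator `q^{-1/2} A`. -/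
def normAdjOp (q : ℕ) : L2 V →L[ℂ] L2 V := (((q : ℝ) ^ (-(1 / 2 : ℝ)) : ℝ) : ℂ) • G.adjOp

end MultiGraph

/-- `μ` is the spectral measure of the operator `T` on `ℓ²(V)` at the vector `φ`: a probability
measure with `∫ P dμ = ⟨φ, P(T) φ⟩` for every real polynomial `P`. -/
def IsSpectralMeasure {V : Type*} (T : L2 V →L[ℂ] L2 V) (φ : L2 V)
    (μ : MeasureTheory.Measure ℝ) : Prop :=
  MeasureTheory.IsProbabilityMeasure μ ∧ ∀ P : Polynomial ℝ,
    MeasureTheory.Integrable (fun x => P.eval x) μ ∧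
      ((∫ x, P.eval x ∂μ : ℝ) : ℂ)
        = inner ℂ φ (Polynomial.aeval T (P.map (algebraMap ℝ ℂ)) φ)

/-- The Kesten-McKay distribution `μ_q`, with its density on `[-2, 2]` with respect to Lebesgue
measure. For `q = 1` the density equals `1 / (π √(4 - x²))` on `(-2, 2)`. -/
def kestenMcKay (q : ℕ) : MeasureTheory.Measure ℝ :=
  (MeasureTheory.volume.restrict (Set.Icc (-2 : ℝ) 2)).withDensity fun x =>
    ENNReal.ofReal (1 / (2 * Real.pi) * ((((q : ℝ) + 1) * √(4 - x ^ 2)) /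
      (((q : ℝ) ^ (-(1 / 2 : ℝ)) + (q : ℝ) ^ (1 / 2 : ℝ)) ^ 2 - x ^ 2)))

open PowerSeries in
/-- The power series `∑ X_{r,q}(x) t^r = (1 - q⁻¹ t²) / (1 - x t + t²)` in the variable `t`, with
coefficients in the polynomial ring `ℝ[x]`. -/
def chebyshevGen (q : ℕ) : PowerSeries (Polynomial ℝ) :=
  (1 - C (Polynomial.C ((q : ℝ)⁻¹)) * X ^ 2) * invOfUnit (1 - C Polynomial.X * X + X ^ 2) 1

/-- The Chebyshev-type polynomial `X_{r,q}`. -/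
def chebyshevX (r q : ℕ) : Polynomial ℝ := PowerSeries.coeff r (chebyshevGen q)

/-- The interior `Ω(ρ)` of the ellipse with semi-axes `ρ + ρ⁻¹` and `|ρ - ρ⁻¹|`. -/
def ellipseInterior (ρ : ℝ) : Set ℂ :=
  {w : ℂ | w.re ^ 2 / (ρ + ρ⁻¹) ^ 2 + w.im ^ 2 / (ρ - ρ⁻¹) ^ 2 < 1}

/-- The coefficient `a_{r,q}(h) = ‖X_{r,q}‖⁻² ∫ h X_{r,q} dμ_q`, for `r ≥ 1`, where
`‖X_{r,q}‖² = 1 + q⁻¹` is the square of the norm of `X_{r,q}` in `L²(μ_q)`. -/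
def chebyshevCoeff (r q : ℕ) (h : ℂ → ℂ) : ℂ :=
  (1 + (q : ℂ)⁻¹)⁻¹ *
    ∫ x in Set.Icc (-2 : ℝ) 2, h (x : ℂ) * (((chebyshevX r q).eval x : ℝ) : ℂ) ∂(kestenMcKay q)

end

/-!
The matrices `A_r` satisfy `A_1 = A`, `A_2 = A A_1 - (q + 1)` and `A_{r+3} = A A_{r+2} - q A_{r+1}`
(`MultiGraph.nbEntry_add_three`), which is the recursion of the polynomials `X_{r,q}` in disguise,
so `q^{-r/2} A_r = X_{r,q}(q^{-1/2} A)` (`MultiGraph.nbOp_eq`). Since `‖A‖ ≤ q + 1`, the spectrum of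
`q^{-1/2} A` lies in the real interval `|x| ≤ √q + 1/√q`. Hence the formula follows once
`h = ∑ a_r X_{r,q}`, with `a_0 = ∫ h dμ_q` and `a_r = a_{r,q}(h)` for `r ≥ 1`, is known uniformly on
that interval: there `X_{r,q}` grows at most like `r q^{r/2}` (`abs_eval_chebyshevX_le`), and the
continuous functional calculus turns uniform convergence into convergence in norm
(`MultiGraph.hasSum_cfc_normAdjOp`).

The scalar expansion comes from the Joukowski map `J(t) = t + t⁻¹`, which sends the annulus
`ρ⁻¹ < |t| ≤ 1` into `Ω(ρ)`. The function `(1 - t²) / (1 - xt + t²) = (t⁻¹ - t) / (J(t) - x)` is a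
Cauchy kernel in the variable `J(t)`, and by the generating function it equals
`m(t) ∑ X_{r,q}(x) t^r` with `m(t) = (1 - t²) / (1 - t²/q)`. Integrating it against `h(J(t))` over a
circle of radius `τ` with `ρ⁻¹ < τ < q^{-1/2}` gives `h(x) = ∑ a_r X_{r,q}(x)`, where `a_r` is the
mean of `h(J(t)) m(t) t^r`, which is `O(τ^r)` (`hasSum_contourCoeff_mul_chebyshevX`). These
means do not depend on `τ`. For `τ = 1` they are integrals against `μ_q`, since the substitution `x = 2 cos θ`
turns `dμ_q` into a multiple of `|m(e^{iθ})|² dθ` and, for `r ≥ 1`, `X_{r,q} |m|²` is the sum of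
`t^r m(t)` and its conjugate (`chebyshevCoeff_eq_contourCoeff`, `integral_eq_contourCoeff`).

On a tree the operators `A_r` with `r ≥ 1` have zero diagonal, so the formula for a polynomial `h`
shows that `μ_q` is the spectral measure (`MultiGraph.isSpectralMeasure_of_isTree`); the polynomial
`1` gives the total mass.
-/

/-! ### The polynomials `X_{r,q}` -/

section Chebyshev

open Polynomial

theorem chebyshevGen_mul (q : ℕ) :
    chebyshevGen q * (1 - PowerSeries.C (X : ℝ[X]) * PowerSeries.X + PowerSeries.X ^ 2)
      = 1 - PowerSeries.C (C ((q : ℝ)⁻¹)) * PowerSeries.X ^ 2 := by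
  rw [chebyshevGen, mul_assoc, PowerSeries.invOfUnit_mul _ _ (by simp), mul_one]

theorem coeff_chebyshevGen_mul (q n : ℕ) :
    PowerSeries.coeff n (chebyshevGen q *
      (1 - PowerSeries.C (X : ℝ[X]) * PowerSeries.X + PowerSeries.X ^ 2))
      = chebyshevX n q - (if 1 ≤ n then chebyshevX (n - 1) q * X else 0)
        + (if 2 ≤ n then chebyshevX (n - 2) q else 0) := by
  rw [mul_add, mul_sub, mul_one, ← mul_assoc, map_add, map_sub, PowerSeries.coeff_mul_X_pow',
    ← pow_one (PowerSeries.X : PowerSeries ℝ[X]), PowerSeries.coeff_mul_X_pow',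
    PowerSeries.coeff_mul_C]
  rfl

theorem chebyshevX_zero (q : ℕ) : chebyshevX 0 q = 1 := by
  have h := coeff_chebyshevGen_mul q 0
  rw [chebyshevGen_mul] at h
  simpa [PowerSeries.coeff_X_pow] using h.symm

theorem chebyshevX_one (q : ℕ) : chebyshevX 1 q = X := by
  have h := coeff_chebyshevGen_mul q 1
  rw [chebyshevGen_mul] at h
  simp [PowerSeries.coeff_X_pow, PowerSeries.coeff_one, PowerSeries.coeff_C_mul,
    chebyshevX_zero] at h
  linear_combination -h

theorem chebyshevX_two (q : ℕ) : chebyshevX 2 q = X ^ 2 - 1 - C ((q : ℝ)⁻¹) := by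
  have h := coeff_chebyshevGen_mul q 2
  rw [chebyshevGen_mul] at h
  simp only [map_sub, PowerSeries.coeff_one, PowerSeries.coeff_C_mul, PowerSeries.coeff_X_pow] at h
  simp [chebyshevX_zero, chebyshevX_one] at h
  linear_combination -h

theorem chebyshevX_add_three (q r : ℕ) :
    chebyshevX (r + 3) q = X * chebyshevX (r + 2) q - chebyshevX (r + 1) q := by
  have h := coeff_chebyshevGen_mul q (r + 3)
  rw [chebyshevGen_mul] at h
  simp [PowerSeries.coeff_one, PowerSeries.coeff_C_mul, PowerSeries.coeff_X_pow] at h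
  linear_combination -h

theorem eval_map_ofReal (P : ℝ[X]) (x : ℝ) :
    (P.map (algebraMap ℝ ℂ)).eval (x : ℂ) = ((P.eval x : ℝ) : ℂ) := by
  rw [eval_map_algebraMap]
  exact aeval_algebraMap_apply_eq_algebraMap_eval x _

/-- Every complex number is of the form `u + u⁻¹` with `|u| ≥ 1`. -/
theorem exists_joukowski_eq (z : ℂ) : ∃ u : ℂ, 1 ≤ ‖u‖ ∧ z = u + u⁻¹ := by
  obtain ⟨y, hy⟩ := IsAlgClosed.exists_pow_nat_eq (z ^ 2 - 4) (n := 2) (by norm_num)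
  have hne : (z + y) / 2 ≠ 0 := by
    intro h0
    have h1 : z + y = 0 := by simpa using h0
    have : (4 : ℂ) = 0 := by linear_combination (z - y) * h1 + hy
    norm_num at this
  have hinv : ((z + y) / 2)⁻¹ = (z - y) / 2 := by
    rw [inv_eq_iff_eq_inv, eq_comm, inv_eq_iff_eq_inv, eq_comm, inv_eq_of_mul_eq_one_right]
    linear_combination -hy / 4
  rcases le_total 1 ‖(z + y) / 2‖ with h | h
  · exact ⟨_, h, by rw [hinv]; ring⟩
  · refine ⟨((z + y) / 2)⁻¹, ?_, by rw [inv_inv, hinv]; ring⟩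
    rw [norm_inv]
    exact (one_le_inv₀ (norm_pos_iff.2 hne)).2 h

/-- If `u + u⁻¹` is a real point of `[-(s + s⁻¹), s + s⁻¹]`, then `|u| ≤ s`. -/
theorem norm_le_of_joukowski_real {s x : ℝ} (hs : 1 ≤ s) (hx : |x| ≤ s + s⁻¹) {u : ℂ}
    (hu : 1 ≤ ‖u‖) (hxu : (x : ℂ) = u + u⁻¹) : ‖u‖ ≤ s := by
  rcases hu.eq_or_lt with h1 | h1
  · exact h1 ▸ hs
  have hpos : 0 < ‖u‖ := by linarith
  have hn : Complex.normSq u = ‖u‖ ^ 2 := Complex.normSq_eq_norm_sq u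
  -- the imaginary part of `u + u⁻¹` is `Im u * (1 - |u|⁻²)`
  have him : u.im = 0 := by
    have h := congrArg Complex.im hxu
    rw [Complex.ofReal_im, Complex.add_im, Complex.inv_im, hn] at h
    have h2 : u.im * (1 - (‖u‖ ^ 2)⁻¹) = 0 := by rw [h]; ring
    rcases mul_eq_zero.1 h2 with h3 | h3
    · exact h3
    · have : (‖u‖ ^ 2)⁻¹ < 1 := inv_lt_one_of_one_lt₀ (by nlinarith)
      linarith
  have hre : u = (u.re : ℂ) := by apply Complex.ext <;> simp [him]
  have hur : ‖u‖ = |u.re| := by rw [hre]; simp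
  have hx2 : x = u.re + u.re⁻¹ := by
    rw [hre] at hxu
    exact_mod_cast hxu
  have hx3 : |x| = ‖u‖ + ‖u‖⁻¹ := by
    rw [hx2, hur]
    rcases le_total 0 u.re with h | h
    · rw [abs_of_nonneg h, abs_of_nonneg (by positivity)]
    · rw [abs_of_nonpos h, abs_of_nonpos (add_nonpos h (inv_nonpos.2 h)), inv_neg]
      ring
  by_contra! hlt
  rw [hx3] at hx
  have hspos : 0 < s := by linarith
  have e : ‖u‖ + ‖u‖⁻¹ - (s + s⁻¹) = (‖u‖ - s) * (1 - (‖u‖ * s)⁻¹) := by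
    field_simp
    ring
  have : (‖u‖ * s)⁻¹ < 1 := inv_lt_one_of_one_lt₀ (by nlinarith)
  nlinarith [mul_pos (sub_pos.2 hlt) (sub_pos.2 this)]

/-- Linear-times-exponential bound for `X_{r,q}` on the interval that carries the spectrum of the
normalized adjacency operator. With `x = u + u⁻¹` the differences `X_{r+1} - u X_r` satisfy a
two-term recursion with ratio `u⁻¹`, so they stay bounded. -/
theorem abs_eval_chebyshevX_le {q : ℕ} (hq : 1 ≤ q) {s x : ℝ} (hs : 1 ≤ s)
    (hx : |x| ≤ s + s⁻¹) (r : ℕ) : |(chebyshevX r q).eval x| ≤ (2 * r + 1) * s ^ r := by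
  obtain ⟨u, hu, hxu⟩ := exists_joukowski_eq x
  have hus := norm_le_of_joukowski_real hs hx hu hxu
  have hu0 : u ≠ 0 := by rintro rfl; norm_num at hu
  set Y : ℕ → ℂ := fun r => (((chebyshevX r q).eval x : ℝ) : ℂ) with hY
  have hq1 : ‖((q : ℂ))⁻¹‖ ≤ 1 := by
    rw [norm_inv, Complex.norm_natCast]
    exact inv_le_one_of_one_le₀ (by exact_mod_cast hq)
  have hui : ‖u⁻¹‖ ≤ 1 := by rw [norm_inv]; exact inv_le_one_of_one_le₀ hu
  have h0 : Y 0 = 1 := by simp [hY, chebyshevX_zero]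
  have h1 : Y 1 = u + u⁻¹ := by simp [hY, chebyshevX_one, hxu]
  have h2 : Y 2 = (u + u⁻¹) ^ 2 - 1 - (q : ℂ)⁻¹ := by simp [hY, chebyshevX_two, hxu]
  have h3 : ∀ r, Y (r + 3) = (u + u⁻¹) * Y (r + 2) - Y (r + 1) := by
    intro r; simp [hY, chebyshevX_add_three, hxu]
  have hd1 : ∀ r, ‖Y (r + 2) - u * Y (r + 1)‖ ≤ 2 := by
    intro r
    induction r with
    | zero =>
      have : Y 2 - u * Y 1 = u⁻¹ ^ 2 - (q : ℂ)⁻¹ := by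
        rw [h1, h2]; field_simp; ring
      rw [zero_add, zero_add, this]
      refine (norm_sub_le _ _).trans ?_
      rw [norm_pow]
      nlinarith [norm_nonneg (u⁻¹)]
    | succ r ih =>
      have : Y (r + 1 + 2) - u * Y (r + 1 + 1) = u⁻¹ * (Y (r + 2) - u * Y (r + 1)) := by
        rw [show r + 1 + 2 = r + 3 from rfl, h3]; field_simp; ring
      rw [this, norm_mul]
      nlinarith [norm_nonneg (Y (r + 2) - u * Y (r + 1)), norm_nonneg (u⁻¹)]
  have hd : ∀ r, ‖Y (r + 1) - u * Y r‖ ≤ 2 := by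
    rintro (_ | r)
    · rw [zero_add, h0, h1]; ring_nf; linarith
    · exact hd1 r
  have key : ∀ r : ℕ, ‖Y r‖ ≤ (2 * r + 1) * s ^ r := by
    intro r
    induction r with
    | zero => simp [h0]
    | succ r ih =>
      have e : Y (r + 1) = u * Y r + (Y (r + 1) - u * Y r) := by ring
      have hp : 1 ≤ s ^ (r + 1) := one_le_pow₀ hs
      calc ‖Y (r + 1)‖ ≤ ‖u‖ * ‖Y r‖ + 2 := by
            rw [e]
            refine (norm_add_le _ _).trans ?_
            rw [norm_mul]
            gcongr
            simpa using hd r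
        _ ≤ s * ((2 * r + 1) * s ^ r) + 2 * s ^ (r + 1) := by
            gcongr
            linarith
        _ = (2 * ((r + 1 : ℕ) : ℝ) + 1) * s ^ (r + 1) := by push_cast; ring
  simpa [hY] using key r

theorem one_le_sqrt_natCast {q : ℕ} (hq : 1 ≤ q) : 1 ≤ √(q : ℝ) :=
  Real.one_le_sqrt.2 (by exact_mod_cast hq)

theorem summable_linear_mul_pow {y : ℝ} (h0 : 0 ≤ y) (h1 : y < 1) :
    Summable fun r : ℕ => (2 * (r : ℝ) + 1) * y ^ r := by
  have a := summable_pow_mul_geometric_of_norm_lt_one 1 (r := y) (by rwa [Real.norm_of_nonneg h0])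
  have b := summable_geometric_of_lt_one h0 h1
  refine ((a.mul_left 2).add b).congr fun r => ?_
  ring

/-- The generating function of the values `X_{r,q}(x)`, as a convergent series. -/
theorem tsum_chebyshevX_mul_pow {q : ℕ} {x : ℝ} {t : ℂ}
    (hsum : Summable fun r : ℕ => (((chebyshevX r q).eval x : ℝ) : ℂ) * t ^ r) :
    (1 - x * t + t ^ 2) * ∑' r : ℕ, (((chebyshevX r q).eval x : ℝ) : ℂ) * t ^ r
      = 1 - (q : ℂ)⁻¹ * t ^ 2 := by
  set Y : ℕ → ℂ := fun r => (((chebyshevX r q).eval x : ℝ) : ℂ) with hY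
  have h0 : Y 0 = 1 := by simp [hY, chebyshevX_zero]
  have h1 : Y 1 = x := by simp [hY, chebyshevX_one]
  have h2 : Y 2 = x ^ 2 - 1 - (q : ℂ)⁻¹ := by simp [hY, chebyshevX_two]
  have h3 : ∀ r, Y (r + 3) = x * Y (r + 2) - Y (r + 1) := by
    intro r; simp [hY, chebyshevX_add_three]
  change Summable fun r => Y r * t ^ r at hsum
  have s1 := (summable_nat_add_iff 1).2 hsum
  have s2 := (summable_nat_add_iff 2).2 hsum
  have e1 := hsum.sum_add_tsum_nat_add 1
  have e2 := hsum.sum_add_tsum_nat_add 2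
  have e3 := hsum.sum_add_tsum_nat_add 3
  have e4 : ∑' r, Y (r + 3) * t ^ (r + 3)
      = x * t * ∑' r, Y (r + 2) * t ^ (r + 2) - t ^ 2 * ∑' r, Y (r + 1) * t ^ (r + 1) := by
    rw [← tsum_mul_left, ← tsum_mul_left, ← (s2.mul_left _).tsum_sub (s1.mul_left _)]
    refine tsum_congr fun r => ?_
    rw [h3]; ring
  simp only [Finset.sum_range_succ, Finset.sum_range_zero, h0, h1, h2] at e1 e2 e3
  change (1 - x * t + t ^ 2) * (∑' r, Y r * t ^ r) = _
  linear_combination -e3 + e4 + x * t * e2 - t ^ 2 * e1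

end Chebyshev

/-! ### Expansion of holomorphic functions on an ellipse -/

section ContourIntegrals

open Complex Metric Set Real MeasureTheory

/-- The Joukowski map `t ↦ t + t⁻¹`. -/
noncomputable def joukowski (t : ℂ) : ℂ := t + t⁻¹

theorem joukowski_inv (t : ℂ) : joukowski t⁻¹ = joukowski t := by
  simp [joukowski, add_comm]

/-- The factor `(1 - t²) / (1 - q⁻¹ t²)`, with its removable singularities at `t = ±1` removed for
`q = 1`, where it is identically `1`. -/
noncomputable def kmFactor (q : ℕ) (t : ℂ) : ℂ :=
  if q = 1 then 1 else (1 - t ^ 2) / (1 - (q : ℂ)⁻¹ * t ^ 2)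

theorem one_sub_inv_mul_sq_ne_zero {q : ℕ} (hq : 1 ≤ q) (hq1 : q ≠ 1) {t : ℂ} (ht : ‖t‖ ≤ 1) :
    1 - (q : ℂ)⁻¹ * t ^ 2 ≠ 0 := by
  intro h
  have hq2 : (1 : ℝ) < q := by exact_mod_cast lt_of_le_of_ne hq (Ne.symm hq1)
  have h1 : (q : ℂ)⁻¹ * t ^ 2 = 1 := (sub_eq_zero.1 h).symm
  have h2 := congrArg norm h1
  rw [norm_mul, norm_pow, norm_inv, Complex.norm_natCast, norm_one] at h2
  have h3 : ‖t‖ ^ 2 ≤ 1 := pow_le_one₀ (norm_nonneg _) ht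
  have h4 : (q : ℝ)⁻¹ < 1 := inv_lt_one_of_one_lt₀ hq2
  have h5 : 0 < (q : ℝ)⁻¹ := by positivity
  nlinarith

theorem kmFactor_mul {q : ℕ} (hq : 1 ≤ q) {t : ℂ} (ht : ‖t‖ ≤ 1) :
    kmFactor q t * (1 - (q : ℂ)⁻¹ * t ^ 2) = 1 - t ^ 2 := by
  unfold kmFactor
  split_ifs with h
  · simp [h]
  · exact div_mul_cancel₀ _ (one_sub_inv_mul_sq_ne_zero hq h ht)

theorem differentiableAt_kmFactor {q : ℕ} (hq : 1 ≤ q) {t : ℂ} (ht : ‖t‖ ≤ 1) :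
    DifferentiableAt ℂ (kmFactor q) t := by
  unfold kmFactor
  split_ifs with h
  · exact differentiableAt_const _
  · exact DifferentiableAt.div (by fun_prop) (by fun_prop) (one_sub_inv_mul_sq_ne_zero hq h ht)

theorem isOpen_ellipseInterior (ρ : ℝ) : IsOpen (ellipseInterior ρ) := by
  unfold ellipseInterior
  exact isOpen_lt (by fun_prop) continuous_const

theorem add_inv_lt_add_inv {a b : ℝ} (ha : 1 ≤ a) (hab : a < b) : a + a⁻¹ < b + b⁻¹ := by
  have e : b + b⁻¹ - (a + a⁻¹) = (b - a) * (1 - (a * b)⁻¹) := by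
    have ha0 : a ≠ 0 := by linarith
    have hb0 : b ≠ 0 := by linarith
    field_simp
    ring
  have : (a * b)⁻¹ < 1 := inv_lt_one_of_one_lt₀ (by nlinarith)
  nlinarith [mul_pos (sub_pos.2 hab) (sub_pos.2 this)]

theorem ofReal_mem_ellipseInterior {s ρ x : ℝ} (hs : 1 ≤ s) (hρ : s < ρ)
    (hx : |x| ≤ s + s⁻¹) : (x : ℂ) ∈ ellipseInterior ρ := by
  have h1 := hx.trans_lt (add_inv_lt_add_inv hs hρ)
  have hρ0 : 0 < ρ := by linarith
  change (x : ℂ).re ^ 2 / (ρ + ρ⁻¹) ^ 2 + (x : ℂ).im ^ 2 / (ρ - ρ⁻¹) ^ 2 < 1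
  rw [Complex.ofReal_re, Complex.ofReal_im, zero_pow two_ne_zero, zero_div, add_zero,
    div_lt_one (by positivity), sq_lt_sq, abs_of_pos (a := ρ + ρ⁻¹) (by positivity)]
  exact h1

/-- The Joukowski map sends the half-open annulus `ρ⁻¹ < |t| ≤ 1` into the ellipse `Ω(ρ)`. -/
theorem joukowski_mem_ellipseInterior {ρ : ℝ} (hρ : 1 < ρ) {t : ℂ} (h1 : ρ⁻¹ < ‖t‖)
    (h2 : ‖t‖ ≤ 1) : joukowski t ∈ ellipseInterior ρ := by
  have hρ0 : 0 < ρ := by linarith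
  have ht : 0 < ‖t‖ := (inv_pos.2 hρ0).trans h1
  have hn : normSq t = ‖t‖ ^ 2 := normSq_eq_norm_sq t
  have hsq : t.re ^ 2 + t.im ^ 2 = ‖t‖ ^ 2 := by rw [← hn, normSq_apply]; ring
  set R := ‖t‖⁻¹ with hR
  have hR1 : 1 ≤ R := (one_le_inv₀ ht).2 h2
  have hRρ : R < ρ := (inv_lt_comm₀ hρ0 ht).1 h1
  have htR : ‖t‖ = R⁻¹ := by rw [hR, inv_inv]
  have hre : (joukowski t).re = (t.re * R) * (R + R⁻¹) := by
    rw [joukowski, add_re, inv_re, hn, htR]; field_simp; ring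
  have him : (joukowski t).im = (t.im * R) * (R⁻¹ - R) := by
    rw [joukowski, add_im, inv_im, hn, htR]; field_simp; ring
  have hcs : (t.re * R) ^ 2 + (t.im * R) ^ 2 = 1 := by
    rw [mul_pow, mul_pow, ← add_mul, hsq, htR]; field_simp
  have hlt := add_inv_lt_add_inv hR1 hRρ
  have hinv : ρ⁻¹ < R⁻¹ := htR ▸ h1
  have hRi : R⁻¹ ≤ 1 := htR ▸ h2
  have ha : (R + R⁻¹) ^ 2 / (ρ + ρ⁻¹) ^ 2 < 1 := by
    rw [div_lt_one (by positivity)]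
    exact pow_lt_pow_left₀ hlt (by positivity) (by norm_num)
  have hpos : 0 < ρ - ρ⁻¹ := by linarith
  have hb : (R⁻¹ - R) ^ 2 / (ρ - ρ⁻¹) ^ 2 < 1 := by
    rw [div_lt_one (by positivity)]
    nlinarith
  change (joukowski t).re ^ 2 / _ + (joukowski t).im ^ 2 / _ < 1
  rw [hre, him, mul_pow _ (R + R⁻¹), mul_pow _ (R⁻¹ - R), mul_div_assoc, mul_div_assoc]
  have h3 : ∀ a b c d : ℝ, 0 ≤ a → 0 ≤ b → a + b = 1 → c < 1 → d < 1 → a * c + b * d < 1 := by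
    intro a b c d ha hb hab hc hd
    rcases ha.eq_or_lt with h | h
    · nlinarith
    · nlinarith [mul_pos h (sub_pos.2 hc), mul_nonneg hb (sub_pos.2 hd).le]
  exact h3 _ _ _ _ (sq_nonneg _) (sq_nonneg _) hcs ha hb

theorem differentiableAt_comp_joukowski {ρ : ℝ} (hρ : 1 < ρ) {k : ℂ → ℂ}
    (hk : DifferentiableOn ℂ k (ellipseInterior ρ)) {t : ℂ} (h1 : ρ⁻¹ < ‖t‖) (h2 : ‖t‖ ≤ 1) :
    DifferentiableAt ℂ (fun t => k (joukowski t)) t := by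
  have ht : t ≠ 0 := norm_pos_iff.1 ((inv_pos.2 (by linarith)).trans h1)
  have hd := hk.differentiableAt
    ((isOpen_ellipseInterior ρ).mem_nhds (joukowski_mem_ellipseInterior hρ h1 h2))
  refine DifferentiableAt.comp t hd ?_
  unfold joukowski
  exact differentiableAt_id.add (differentiableAt_inv ht)

theorem continuousOn_comp_joukowski {ρ : ℝ} (hρ : 1 < ρ) {h : ℂ → ℂ}
    (hh : DifferentiableOn ℂ h (ellipseInterior ρ)) :
    ContinuousOn (fun t => h (joukowski t)) (Metric.sphere 0 1) := fun t ht =>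
  have ht' : ‖t‖ = 1 := by simpa using ht
  (differentiableAt_comp_joukowski hρ hh (by rw [ht']; exact inv_lt_one_of_one_lt₀ hρ)
    ht'.le).continuousAt.continuousWithinAt

/-- The mean of a holomorphic function over the circles of an annulus does not depend on the
radius. -/
theorem circleAverage_eq_of_annulus {F : ℂ → ℂ} {τ : ℝ} (h0 : 0 < τ) (h1 : τ ≤ 1)
    (hF : ∀ t : ℂ, τ ≤ ‖t‖ → ‖t‖ ≤ 1 → DifferentiableAt ℂ F t) :
    circleAverage F 0 τ = circleAverage F 0 1 := by
  rw [circleAverage_eq_circleIntegral h0.ne', circleAverage_eq_circleIntegral one_ne_zero]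
  congr 1
  refine (circleIntegral_sub_center_inv_smul_eq_of_differentiable_on_annulus_off_countable
    h0 h1 countable_empty ?_ ?_).symm
  · rintro t ⟨ht1, ht2⟩
    exact (hF t (by simpa using ht2) (by simpa using ht1)).continuousAt.continuousWithinAt
  · rintro t ⟨⟨ht1, ht2⟩, -⟩
    exact hF t (by simpa using (not_le.1 (fun h => ht2 (by simpa using h))).le)
      (by simpa using (mem_ball.1 ht1).le)

/-- `∮ k(J(t)) J'(t) dt = 0` for the Joukowski map `J`: on the unit circle the integrand is odd
under `t ↦ t⁻¹`. -/
theorem circleAverage_joukowski_odd {ρ : ℝ} (hρ : 1 < ρ) {k : ℂ → ℂ}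
    (hk : DifferentiableOn ℂ k (ellipseInterior ρ)) {τ : ℝ} (h0 : ρ⁻¹ < τ) (h1 : τ ≤ 1) :
    circleAverage (fun t => k (joukowski t) * (t⁻¹ - t)) 0 τ = 0 := by
  have hτ : 0 < τ := (inv_pos.2 (by linarith)).trans h0
  rw [circleAverage_eq_of_annulus hτ h1]
  · set c := circleAverage (fun t => k (joukowski t) * (t⁻¹ - t)) 0 1 with hc
    have h := circleAverage_zero_one_congr_inv (f := fun t => k (joukowski t) * (t⁻¹ - t))
    have h2 : (fun t : ℂ => k (joukowski t⁻¹) * (t⁻¹⁻¹ - t⁻¹))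
        = (-1 : ℂ) • fun t => k (joukowski t) * (t⁻¹ - t) := by
      funext t
      simp only [joukowski_inv, inv_inv, Pi.smul_apply, smul_eq_mul]
      ring
    rw [h2, circleAverage_smul, ← hc] at h
    rw [smul_eq_mul] at h
    linear_combination -h / 2
  · intro t ht1 ht2
    have ht : t ≠ 0 := norm_pos_iff.1 (hτ.trans_le ht1)
    exact (differentiableAt_comp_joukowski hρ hk (h0.trans_le ht1) ht2).mul
      ((differentiableAt_inv ht).sub differentiableAt_id)

/-- The coefficient `a_{r,q}(h)` as a contour integral over the circle of radius `τ`. -/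
noncomputable def contourCoeff (q : ℕ) (h : ℂ → ℂ) (τ : ℝ) (r : ℕ) : ℂ :=
  circleAverage (fun t => h (joukowski t) * kmFactor q t * t ^ r) 0 τ

theorem contourCoeff_eq_one {q : ℕ} (hq : 1 ≤ q) {ρ : ℝ} (hρ : 1 < ρ) {h : ℂ → ℂ}
    (hh : DifferentiableOn ℂ h (ellipseInterior ρ)) {τ : ℝ} (h0 : ρ⁻¹ < τ) (h1 : τ ≤ 1) (r : ℕ) :
    contourCoeff q h τ r = contourCoeff q h 1 r := by
  refine circleAverage_eq_of_annulus ((inv_pos.2 (by linarith)).trans h0) h1 fun t ht1 ht2 => ?_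
  exact ((differentiableAt_comp_joukowski hρ hh (h0.trans_le ht1) ht2).mul
    (differentiableAt_kmFactor hq ht2)).mul (by fun_prop)

theorem exists_norm_comp_joukowski_le {q : ℕ} (hq : 1 ≤ q) {ρ : ℝ} (hρ : 1 < ρ) {h : ℂ → ℂ}
    (hh : DifferentiableOn ℂ h (ellipseInterior ρ)) {τ : ℝ} (h0 : ρ⁻¹ < τ) (h1 : τ ≤ 1) :
    ∃ B, ∀ t ∈ sphere (0 : ℂ) τ, ‖h (joukowski t) * kmFactor q t‖ ≤ B := by
  refine (isCompact_sphere (0 : ℂ) τ).exists_bound_of_continuousOn fun t ht => ?_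
  have ht' : ‖t‖ = τ := by simpa using ht
  exact ((differentiableAt_comp_joukowski hρ hh (ht' ▸ h0) (ht' ▸ h1)).mul
    (differentiableAt_kmFactor hq (ht' ▸ h1))).continuousAt.continuousWithinAt

theorem norm_circleAverage_le {F : ℂ → ℂ} {τ B : ℝ} (hτ : 0 ≤ τ)
    (hB : ∀ t ∈ sphere (0 : ℂ) τ, ‖F t‖ ≤ B) : ‖circleAverage F 0 τ‖ ≤ B := by
  rw [circleAverage_def, norm_smul, norm_inv, norm_of_nonneg (by positivity : 0 ≤ 2 * π)]
  have h := intervalIntegral.norm_integral_le_of_norm_le_const (a := 0) (b := 2 * π)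
    (f := fun θ => F (circleMap 0 τ θ)) (C := B)
    fun θ _ => hB _ (circleMap_mem_sphere 0 hτ θ)
  rw [sub_zero, abs_of_nonneg (by positivity)] at h
  rw [inv_mul_le_iff₀ (by positivity)]
  linarith

/-- A series of functions whose terms are dominated by a summable sequence of constants on a circle
may be averaged term by term. -/
theorem hasSum_circleAverage {F : ℕ → ℂ → ℂ} {f : ℂ → ℂ} {τ : ℝ} (hτ : 0 ≤ τ) {b : ℕ → ℝ}
    (hb : Summable b) (hF : ∀ n, ContinuousOn (F n) (sphere 0 τ))
    (hFb : ∀ n, ∀ t ∈ sphere (0 : ℂ) τ, ‖F n t‖ ≤ b n)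
    (hf : ∀ t ∈ sphere (0 : ℂ) τ, HasSum (fun n => F n t) (f t)) :
    HasSum (fun n => circleAverage (F n) 0 τ) (circleAverage f 0 τ) := by
  have hm : ∀ θ, circleMap 0 τ θ ∈ sphere (0 : ℂ) τ := circleMap_mem_sphere 0 hτ
  refine HasSum.const_smul _ (intervalIntegral.hasSum_integral_of_dominated_convergence
    (fun n _ => b n) (fun n => ?_) (fun n => ?_) ?_ ?_ ?_)
  · exact ((hF n).comp_continuous (continuous_circleMap 0 τ) hm).aestronglyMeasurable
  · exact ae_of_all _ fun θ _ => hFb n _ (hm θ)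
  · exact ae_of_all _ fun θ _ => hb
  · exact intervalIntegrable_const
  · exact ae_of_all _ fun θ _ => hf _ (hm θ)

/-- Decay of the contour coefficients. -/
theorem exists_norm_contourCoeff_le {q : ℕ} (hq : 1 ≤ q) {ρ : ℝ} (hρ : 1 < ρ) {h : ℂ → ℂ}
    (hh : DifferentiableOn ℂ h (ellipseInterior ρ)) {τ : ℝ} (h0 : ρ⁻¹ < τ) (h1 : τ ≤ 1) :
    ∃ B, ∀ r, ‖contourCoeff q h τ r‖ ≤ B * τ ^ r := by
  have hτ : 0 < τ := (inv_pos.2 (by linarith)).trans h0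
  obtain ⟨B, hB⟩ := exists_norm_comp_joukowski_le hq hρ hh h0 h1
  refine ⟨B, fun r => norm_circleAverage_le hτ.le fun t ht => ?_⟩
  rw [norm_mul, norm_pow, mem_sphere_zero_iff_norm.1 ht]
  gcongr
  exact hB t ht

/-- The expansion of a holomorphic function in the polynomials `X_{r,q}`, pointwise on the interval
`[-(s + s⁻¹), s + s⁻¹]` with `1 ≤ s < ρ`. Since `t⁻¹ (1 - xt + t²) = J(t) - x`, the function
`f = (1 - t²) / (1 - xt + t²)`, whose Taylor series is `kmFactor q t * ∑ X_r(x) t^r`, is a Cauchy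
kernel in the Joukowski variable: the mean of `(h(J(t)) - h(x)) f(t)` is that of
`k(J(t)) (t⁻¹ - t)` with `k` the difference quotient of `h` at `x`, hence zero, and the mean of `f`
is `f(0) = 1`. -/
theorem hasSum_contourCoeff_mul_chebyshevX {q : ℕ} (hq : 1 ≤ q) {ρ s τ : ℝ} (hs : 1 ≤ s)
    (hsτ : s * τ < 1) (hρτ : ρ⁻¹ < τ) (hρ : 1 < ρ) {h : ℂ → ℂ}
    (hh : DifferentiableOn ℂ h (ellipseInterior ρ)) {x : ℝ} (hx : |x| ≤ s + s⁻¹)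
    (hxρ : (x : ℂ) ∈ ellipseInterior ρ) :
    HasSum (fun r => contourCoeff q h τ r * (((chebyshevX r q).eval x : ℝ) : ℂ)) (h x) := by
  have hτ : 0 < τ := (inv_pos.2 (by linarith)).trans hρτ
  have hτ1 : τ < 1 := by nlinarith
  have hbound := abs_eval_chebyshevX_le hq hs hx
  set Y : ℕ → ℂ := fun r => (((chebyshevX r q).eval x : ℝ) : ℂ) with hY
  have hYb : ∀ r, ‖Y r‖ * τ ^ r ≤ (2 * (r : ℝ) + 1) * (s * τ) ^ r := by
    intro r
    rw [mul_pow, ← mul_assoc]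
    gcongr
    simpa [hY] using hbound r
  have hsumb : Summable fun r : ℕ => (2 * (r : ℝ) + 1) * (s * τ) ^ r :=
    summable_linear_mul_pow (by positivity) hsτ
  have hsum : ∀ t : ℂ, ‖t‖ ≤ τ → Summable fun r => Y r * t ^ r := by
    intro t ht
    refine Summable.of_norm_bounded hsumb fun r => ?_
    rw [norm_mul, norm_pow]
    exact le_trans (by gcongr) (hYb r)
  have hgen : ∀ t : ℂ, ‖t‖ ≤ τ →
      (1 - x * t + t ^ 2) * ∑' r, Y r * t ^ r = 1 - (q : ℂ)⁻¹ * t ^ 2 :=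
    fun t ht => tsum_chebyshevX_mul_pow (hsum t ht)
  have hne : ∀ t : ℂ, ‖t‖ ≤ τ → 1 - x * t + t ^ 2 ≠ 0 := by
    intro t ht h0
    have h1 := hgen t ht
    rw [h0, zero_mul] at h1
    have h2 := congrArg norm (sub_eq_zero.1 h1.symm)
    rw [norm_one, norm_mul, norm_pow, norm_inv, Complex.norm_natCast] at h2
    have h3 : (q : ℝ)⁻¹ ≤ 1 := inv_le_one_of_one_le₀ (by exact_mod_cast hq)
    have h4 : ‖t‖ ^ 2 < 1 := pow_lt_one₀ (norm_nonneg _) (by linarith) (by norm_num)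
    nlinarith [sq_nonneg ‖t‖]
  set f : ℂ → ℂ := fun t => (1 - t ^ 2) / (1 - x * t + t ^ 2) with hf
  have hfd : ∀ t : ℂ, ‖t‖ ≤ τ → DifferentiableAt ℂ f t := fun t ht =>
    DifferentiableAt.div (by fun_prop) (by fun_prop) (hne t ht)
  have hfs : ∀ t : ℂ, ‖t‖ ≤ τ → HasSum (fun r => kmFactor q t * (Y r * t ^ r)) (f t) := by
    intro t ht
    have h1 := (hsum t ht).hasSum.mul_left (kmFactor q t)
    have h2 : kmFactor q t * ∑' r, Y r * t ^ r = f t := by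
      rw [hf, eq_div_iff (hne t ht), ← kmFactor_mul hq (ht.trans hτ1.le), ← hgen t ht]
      ring
    rwa [h2] at h1
  have hfavg : circleAverage f 0 τ = 1 := by
    have h1 : f 0 = 1 := by simp [hf]
    rw [← h1]
    refine circleAverage_of_differentiable_on_off_countable countable_empty ?_ ?_
    · intro t ht
      rw [abs_of_pos hτ, mem_closedBall_zero_iff] at ht
      exact (hfd t ht).continuousAt.continuousWithinAt
    · rintro t ⟨ht, -⟩
      rw [abs_of_pos hτ, mem_ball_zero_iff] at ht
      exact hfd t ht.le
  have hdh : ∀ t ∈ sphere (0 : ℂ) τ, DifferentiableAt ℂ (fun t => h (joukowski t)) t := by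
    intro t ht
    have ht' : ‖t‖ = τ := by simpa using ht
    exact differentiableAt_comp_joukowski hρ hh (ht' ▸ hρτ) (ht' ▸ hτ1.le)
  have hdf : ∀ t ∈ sphere (0 : ℂ) τ, DifferentiableAt ℂ f t := fun t ht =>
    hfd t (by simpa using (mem_sphere_zero_iff_norm.1 ht).le)
  have hint1 : CircleIntegrable (fun t => h (joukowski t) * f t) 0 τ :=
    ContinuousOn.circleIntegrable hτ.le fun t ht =>
      ((hdh t ht).mul (hdf t ht)).continuousAt.continuousWithinAt
  have hint2 : CircleIntegrable (fun t => h x * f t) 0 τ :=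
    ContinuousOn.circleIntegrable hτ.le fun t ht =>
      ((hdf t ht).const_mul _).continuousAt.continuousWithinAt
  -- the Cauchy formula in the Joukowski variable
  have hcauchy : circleAverage (fun t => h (joukowski t) * f t) 0 τ = h x := by
    have hk : DifferentiableOn ℂ (dslope h x) (ellipseInterior ρ) :=
      (differentiableOn_dslope ((isOpen_ellipseInterior ρ).mem_nhds hxρ)).2 hh
    have h1 := circleAverage_joukowski_odd hρ hk hρτ hτ1.le
    have h2 : circleAverage (fun t => dslope h x (joukowski t) * (t⁻¹ - t)) 0 τ
        = circleAverage (fun t => h (joukowski t) * f t - h x * f t) 0 τ := by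
      refine circleAverage_congr_sphere fun t ht => ?_
      rw [abs_of_pos hτ, mem_sphere_zero_iff_norm] at ht
      have ht0 : t ≠ 0 := norm_pos_iff.1 (by rw [ht]; exact hτ)
      have hn := hne t ht.le
      have hJ : joukowski t - x = (1 - x * t + t ^ 2) / t := by
        unfold joukowski; field_simp; ring
      have hs := sub_smul_dslope h (x : ℂ) (joukowski t)
      rw [smul_eq_mul, hJ] at hs
      simp only [hf]
      rw [← sub_mul, ← hs]
      generalize 1 - x * t + t ^ 2 = d at hn
      field_simp
    rw [h2, circleAverage_fun_sub hint1 hint2] at h1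
    have h3 : circleAverage (fun t => h x * f t) 0 τ = h x := by
      have := circleAverage_fun_smul (a := h x) (f := f) (c := 0) (R := τ)
      simpa [hfavg] using this
    rw [h3] at h1
    exact sub_eq_zero.1 h1
  obtain ⟨B, hB⟩ := exists_norm_comp_joukowski_le hq hρ hh hρτ hτ1.le
  have hB0 : 0 ≤ B := (norm_nonneg _).trans (hB τ (by simp [hτ.le]))
  have main := hasSum_circleAverage (F := fun r t => h (joukowski t) * kmFactor q t * t ^ r * Y r)
    (f := fun t => h (joukowski t) * f t) hτ.le (hsumb.mul_left B) ?_ ?_ ?_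
  · rw [hcauchy] at main
    refine main.congr_fun fun r => ?_
    have := circleAverage_fun_smul (a := Y r)
      (f := fun t => h (joukowski t) * kmFactor q t * t ^ r) (c := 0) (R := τ)
    simp only [smul_eq_mul] at this
    rw [contourCoeff, mul_comm, ← this]
    simp only [mul_comm]
  · intro n t ht
    have ht' : ‖t‖ = τ := by simpa using ht
    exact ((((hdh t ht).mul (differentiableAt_kmFactor hq (ht' ▸ hτ1.le))).mul
      (differentiableAt_id.pow n)).mul_const _).continuousAt.continuousWithinAt
  · intro n t ht
    rw [norm_mul, norm_mul, norm_pow, mem_sphere_zero_iff_norm.1 ht, mul_assoc, mul_comm (τ ^ n)]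
    exact mul_le_mul (hB t ht) (hYb n) (by positivity) hB0
  · intro t ht
    refine ((hfs t (mem_sphere_zero_iff_norm.1 ht).le).mul_left (h (joukowski t))).congr_fun
      fun r => ?_
    ring

end ContourIntegrals

/-! ### The Kesten–McKay distribution in the Joukowski variable -/

section KestenMcKay

open Complex Metric Set Real MeasureTheory

/-- The density of `μ_q` on `[-2, 2]`. At `x = ±2` and `q = 1` it has the value `0`, by division by
zero; these points form a null set. -/
noncomputable def kmDensity (q : ℕ) (x : ℝ) : ℝ :=
  1 / (2 * π) * ((((q : ℝ) + 1) * √(4 - x ^ 2)) /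
    (((q : ℝ) ^ (-(1 / 2 : ℝ)) + (q : ℝ) ^ (1 / 2 : ℝ)) ^ 2 - x ^ 2))

theorem sq_rpow_half_add {q : ℕ} (hq : 1 ≤ q) :
    ((q : ℝ) ^ (-(1 / 2 : ℝ)) + (q : ℝ) ^ (1 / 2 : ℝ)) ^ 2 = q + 2 + (q : ℝ)⁻¹ := by
  have h0 : (0 : ℝ) < q := by exact_mod_cast hq
  have hs : ((q : ℝ) ^ (1 / 2 : ℝ)) ^ 2 = q := by
    rw [← Real.sqrt_eq_rpow, Real.sq_sqrt h0.le]
  have hne : (q : ℝ) ^ (1 / 2 : ℝ) ≠ 0 := (Real.rpow_pos_of_pos h0 _).ne'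
  rw [Real.rpow_neg h0.le, add_sq, inv_pow, hs, mul_assoc, inv_mul_cancel₀ hne]
  ring

theorem kmDensity_nonneg {q : ℕ} (hq : 1 ≤ q) {x : ℝ} (hx : x ∈ Icc (-2 : ℝ) 2) :
    0 ≤ kmDensity q x := by
  have h0 : (1 : ℝ) ≤ q := by exact_mod_cast hq
  unfold kmDensity
  rw [sq_rpow_half_add hq]
  have h1 : x ^ 2 ≤ 4 := by nlinarith [hx.1, hx.2]
  have h2 : 2 ≤ (q : ℝ) + (q : ℝ)⁻¹ := by
    have : (q : ℝ) + (q : ℝ)⁻¹ - 2 = (q - 1) ^ 2 / q := by field_simp; ring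
    have : 0 ≤ ((q : ℝ) - 1) ^ 2 / q := by positivity
    linarith
  have h3 : 0 ≤ (q : ℝ) + 2 + (q : ℝ)⁻¹ - x ^ 2 := by linarith
  positivity

theorem measurable_kmDensity (q : ℕ) : Measurable (kmDensity q) := by
  unfold kmDensity
  fun_prop

theorem kestenMcKay_restrict (q : ℕ) :
    (kestenMcKay q).restrict (Icc (-2) 2) = kestenMcKay q := by
  rw [kestenMcKay, restrict_withDensity measurableSet_Icc,
    Measure.restrict_restrict measurableSet_Icc, inter_self]

theorem integral_kestenMcKay {q : ℕ} (hq : 1 ≤ q) (g : ℝ → ℂ) :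
    ∫ x, g x ∂(kestenMcKay q) = ∫ x in Icc (-2 : ℝ) 2, kmDensity q x • g x := by
  change ∫ x, g x ∂(volume.restrict (Icc (-2) 2)).withDensity
    (fun x => ENNReal.ofReal (kmDensity q x)) = _
  rw [integral_withDensity_eq_integral_toReal_smul (measurable_kmDensity q).ennreal_ofReal
    (ae_of_all _ fun _ => ENNReal.ofReal_lt_top)]
  refine setIntegral_congr_fun measurableSet_Icc fun x hx => ?_
  simp only [ENNReal.toReal_ofReal (kmDensity_nonneg hq hx)]

theorem integrable_kestenMcKay_iff {q : ℕ} (hq : 1 ≤ q) (g : ℝ → ℂ) :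
    Integrable g (kestenMcKay q) ↔
      IntegrableOn (fun x => kmDensity q x • g x) (Icc (-2) 2) := by
  change Integrable g ((volume.restrict (Icc (-2) 2)).withDensity
    (fun x => ENNReal.ofReal (kmDensity q x))) ↔ _
  rw [integrable_withDensity_iff_integrable_smul' (measurable_kmDensity q).ennreal_ofReal
    (ae_of_all _ fun _ => ENNReal.ofReal_lt_top)]
  refine integrableOn_congr_fun (fun x hx => ?_) measurableSet_Icc
  simp only [ENNReal.toReal_ofReal (kmDensity_nonneg hq hx)]

theorem joukowski_circleMap (θ : ℝ) : joukowski (circleMap 0 1 θ) = ((2 * Real.cos θ : ℝ) : ℂ) := by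
  rw [joukowski, circleMap_zero, ofReal_one, one_mul, ← Complex.exp_neg, ofReal_mul, ofReal_cos,
    ofReal_ofNat, Complex.two_cos, neg_mul]

/-- The weight of `μ_q` in the angle `θ`, where `x = 2 cos θ = J(e^{iθ})`. -/
theorem kmDensity_mul_sin {q : ℕ} (hq : 1 ≤ q) {θ : ℝ} (hθ : θ ∈ Ioo 0 π) :
    ((2 * Real.sin θ * kmDensity q (2 * Real.cos θ) : ℝ) : ℂ)
      = ((1 + (q : ℂ)⁻¹) / (2 * π)) *
        (kmFactor q (circleMap 0 1 θ) * kmFactor q (circleMap 0 1 θ)⁻¹) := by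
  have hsin := Real.sin_pos_of_mem_Ioo hθ
  have hcs := Real.sin_sq_add_cos_sq θ
  have hq0 : (0 : ℝ) < q := by exact_mod_cast hq
  have hqC : (q : ℂ) ≠ 0 := by exact_mod_cast hq0.ne'
  have hsqrt : √(4 - (2 * Real.cos θ) ^ 2) = 2 * Real.sin θ := by
    rw [show 4 - (2 * Real.cos θ) ^ 2 = (2 * Real.sin θ) ^ 2 by linear_combination -4 * hcs,
      Real.sqrt_sq (by positivity)]
  rw [kmDensity, sq_rpow_half_add hq, hsqrt]
  by_cases h1 : q = 1
  · subst h1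
    have h2 : ((1 : ℕ) : ℝ) + 2 + ((1 : ℕ) : ℝ)⁻¹ - (2 * Real.cos θ) ^ 2
        = (2 * Real.sin θ) ^ 2 := by
      push_cast
      rw [inv_one]
      linear_combination -4 * hcs
    rw [h2]
    have h3 : 2 * Real.sin θ * (1 / (2 * π) * ((((1 : ℕ) : ℝ) + 1) * (2 * Real.sin θ)
        / (2 * Real.sin θ) ^ 2)) = 2 / (2 * π) := by
      push_cast
      field_simp
      norm_num
    rw [h3]
    simp [kmFactor]
    norm_num
  · set t := circleMap 0 1 θ with ht
    have htn : ‖t‖ = 1 := by simp [ht]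
    have ht0 : t ≠ 0 := norm_pos_iff.1 (by rw [htn]; norm_num)
    have hJ : t + t⁻¹ = 2 * Real.cos θ := by
      have := joukowski_circleMap θ
      rw [joukowski] at this
      rw [← ht] at this
      rw [this]; push_cast; ring
    have hd1 := one_sub_inv_mul_sq_ne_zero hq h1 htn.le
    have hd2 := one_sub_inv_mul_sq_ne_zero hq h1 (t := t⁻¹) (by rw [norm_inv, htn, inv_one])
    have hinv : t * t⁻¹ = 1 := mul_inv_cancel₀ ht0
    have hden : (q : ℂ) + 2 + (q : ℂ)⁻¹ - (2 * Real.cos θ) ^ 2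
        = q * ((1 - (q : ℂ)⁻¹ * t ^ 2) * (1 - (q : ℂ)⁻¹ * t⁻¹ ^ 2)) := by
      rw [← hJ]; field_simp; ring
    have hnum : (4 : ℂ) * Real.sin θ ^ 2 = (1 - t ^ 2) * (1 - t⁻¹ ^ 2) := by
      have hcs' : (Real.sin θ : ℂ) ^ 2 + Real.cos θ ^ 2 = 1 := by exact_mod_cast hcs
      have : (4 : ℂ) * Real.sin θ ^ 2 = 4 - (t + t⁻¹) ^ 2 := by
        rw [hJ]; linear_combination 4 * hcs'
      rw [this]; linear_combination (-3 - t * t⁻¹) * hinv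
    have e : (((2 * Real.sin θ * (1 / (2 * π) * (((q : ℝ) + 1) * (2 * Real.sin θ) /
        ((q : ℝ) + 2 + (q : ℝ)⁻¹ - (2 * Real.cos θ) ^ 2))) : ℝ)) : ℂ)
        = ((q : ℂ) + 1) / (2 * π) * ((4 * Real.sin θ ^ 2)
          / ((q : ℂ) + 2 + (q : ℂ)⁻¹ - (2 * Real.cos θ) ^ 2)) := by
      push_cast; ring
    rw [e, hden, hnum, kmFactor, kmFactor, if_neg h1, if_neg h1]
    generalize 1 - (q : ℂ)⁻¹ * t ^ 2 = d1 at hd1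
    generalize 1 - (q : ℂ)⁻¹ * t⁻¹ ^ 2 = d2 at hd2
    generalize 1 - t⁻¹ ^ 2 = n2
    field_simp

theorem image_two_mul_cos : (fun θ => 2 * Real.cos θ) '' Icc 0 π = Icc (-2) 2 := by
  have h := congrArg (fun s => (fun x : ℝ => 2 * x) '' s) Real.bijOn_cos.image_eq
  simp only [image_image] at h
  rw [h, image_mul_left_Icc (by norm_num) (by norm_num)]
  norm_num

theorem hasDerivAt_two_mul_cos (θ : ℝ) :
    HasDerivAt (fun θ => 2 * Real.cos θ) (-2 * Real.sin θ) θ := by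
  simpa using (Real.hasDerivAt_cos θ).const_mul 2

theorem injOn_two_mul_cos : InjOn (fun θ => 2 * Real.cos θ) (Icc 0 π) := fun _ ha _ hb h =>
  Real.injOn_cos ha hb (mul_left_cancel₀ two_ne_zero h)

/-- The pullback of `g dμ_q` to the unit circle along the Joukowski map, up to normalization. -/
noncomputable def kmPullback (q : ℕ) (g : ℂ → ℂ) (t : ℂ) : ℂ :=
  (1 + (q : ℂ)⁻¹) / 2 * (kmFactor q t * kmFactor q t⁻¹ * g (joukowski t))

theorem kmPullback_inv (q : ℕ) (g : ℂ → ℂ) (t : ℂ) : kmPullback q g t⁻¹ = kmPullback q g t := by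
  rw [kmPullback, kmPullback, joukowski_inv, inv_inv, mul_comm (kmFactor q t⁻¹)]

/-- The integrand of `∫ g dμ_q` after the substitution `x = 2 cos θ`. The end points `θ = 0, π` are
excluded: for `q = 1` the Jacobian vanishes there and the right hand side does not. -/
theorem abs_deriv_smul_kmDensity_smul {q : ℕ} (hq : 1 ≤ q) (g : ℂ → ℂ) {θ : ℝ}
    (hθ : θ ∈ Ioo 0 π) :
    |-2 * Real.sin θ| • (kmDensity q (2 * Real.cos θ) • g ((2 * Real.cos θ : ℝ) : ℂ))
      = (π : ℂ)⁻¹ * kmPullback q g (circleMap 0 1 θ) := by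
  have hsin := Real.sin_pos_of_mem_Ioo hθ
  have habs : |-2 * Real.sin θ| = 2 * Real.sin θ := by
    rw [neg_mul, abs_neg, abs_of_pos (by positivity)]
  rw [habs, smul_smul, Complex.real_smul, kmDensity_mul_sin hq hθ, ← joukowski_circleMap,
    kmPullback, div_mul_eq_div_div]
  ring

theorem continuous_comp_circleMap {F : ℂ → ℂ} (hF : ContinuousOn F (sphere 0 1)) :
    Continuous fun θ => F (circleMap 0 1 θ) :=
  hF.comp_continuous (continuous_circleMap 0 1) (circleMap_mem_sphere 0 zero_le_one)

theorem continuousOn_kmPullback {q : ℕ} (hq : 1 ≤ q) {g : ℂ → ℂ}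
    (hg : ContinuousOn (fun t => g (joukowski t)) (sphere 0 1)) :
    ContinuousOn (kmPullback q g) (sphere 0 1) := by
  have hm : ContinuousOn (kmFactor q) (sphere 0 1) := fun t ht =>
    (differentiableAt_kmFactor hq
      (mem_sphere_zero_iff_norm.1 ht).le).continuousAt.continuousWithinAt
  have hinv : ContinuousOn (fun t : ℂ => t⁻¹) (sphere 0 1) := fun t ht =>
    (continuousAt_inv₀ (norm_pos_iff.1
      (by rw [mem_sphere_zero_iff_norm.1 ht]; norm_num))).continuousWithinAt
  have hm' : ContinuousOn (fun t => kmFactor q t⁻¹) (sphere 0 1) :=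
    hm.comp hinv fun t ht => by
      rw [mem_sphere_zero_iff_norm, norm_inv, mem_sphere_zero_iff_norm.1 ht, inv_one]
  exact continuousOn_const.mul ((hm.mul hm').mul hg)

/-- The substitution `x = 2 cos θ`, whose Jacobian absorbs the possible singularities of the density
at `x = ±2`. -/
theorem integrable_kestenMcKay {q : ℕ} (hq : 1 ≤ q) {g : ℂ → ℂ}
    (hg : ContinuousOn (fun t => g (joukowski t)) (sphere 0 1)) :
    Integrable (fun x : ℝ => g x) (kestenMcKay q) := by
  rw [integrable_kestenMcKay_iff hq, ← image_two_mul_cos,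
    integrableOn_image_iff_integrableOn_abs_deriv_smul measurableSet_Icc
      (fun θ _ => (hasDerivAt_two_mul_cos θ).hasDerivWithinAt) injOn_two_mul_cos,
    integrableOn_Icc_iff_integrableOn_Ioo,
    integrableOn_congr_fun (fun θ hθ => abs_deriv_smul_kmDensity_smul hq g hθ) measurableSet_Ioo,
    ← integrableOn_Icc_iff_integrableOn_Ioo]
  exact (continuous_const.mul
    (continuous_comp_circleMap (continuousOn_kmPullback hq hg))).continuousOn.integrableOn_Icc

/-- A function on the unit circle that is invariant under `t ↦ t⁻¹` has the same mean on the upper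
half circle as on the whole circle. -/
theorem integral_upper_half_circle {F : ℂ → ℂ} (hF : ContinuousOn F (sphere 0 1))
    (hinv : ∀ t, F t⁻¹ = F t) :
    ∫ θ in (0)..π, F (circleMap 0 1 θ) = π * circleAverage F 0 1 := by
  have hc := continuous_comp_circleMap hF
  have hneg : ∀ θ, F (circleMap 0 1 (-θ)) = F (circleMap 0 1 θ) := by
    intro θ
    rw [← hinv (circleMap 0 1 θ)]
    congr 1
    simp [circleMap, Complex.exp_neg]
  have h1 : ∫ θ in (-π)..0, F (circleMap 0 1 θ) = ∫ θ in (0)..π, F (circleMap 0 1 θ) := by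
    have := intervalIntegral.integral_comp_neg (a := 0) (b := π) (fun θ => F (circleMap 0 1 θ))
    rw [neg_zero] at this
    rw [← this]
    simp only [hneg]
  have h2 : ∫ θ in (0)..(2 * π), F (circleMap 0 1 θ) = ∫ θ in (-π)..π, F (circleMap 0 1 θ) := by
    have hp : (fun θ => F (circleMap 0 1 θ)).Periodic (2 * π) := fun x => by
      simp [periodic_circleMap 0 1 x]
    have := hp.intervalIntegral_add_eq 0 (-π)
    rw [zero_add, show -π + 2 * π = π by ring] at this
    exact this
  rw [circleAverage_def, h2, ← intervalIntegral.integral_add_adjacent_intervals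
    (hc.intervalIntegrable (-π) 0) (hc.intervalIntegrable 0 π), h1, Complex.real_smul]
  push_cast
  have : (π : ℂ) ≠ 0 := by exact_mod_cast pi_ne_zero
  field_simp
  ring

theorem integral_kestenMcKay_eq_circleAverage {q : ℕ} (hq : 1 ≤ q) {g : ℂ → ℂ}
    (hg : ContinuousOn (fun t => g (joukowski t)) (sphere 0 1)) :
    ∫ x : ℝ, g x ∂(kestenMcKay q) = circleAverage (kmPullback q g) 0 1 := by
  rw [integral_kestenMcKay hq, ← image_two_mul_cos,
    integral_image_eq_integral_abs_deriv_smul measurableSet_Icc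
      (fun θ _ => (hasDerivAt_two_mul_cos θ).hasDerivWithinAt) injOn_two_mul_cos,
    integral_Icc_eq_integral_Ioo,
    setIntegral_congr_fun measurableSet_Ioo
      (fun θ hθ => abs_deriv_smul_kmDensity_smul hq g hθ),
    ← integral_Ioc_eq_integral_Ioo, integral_const_mul,
    ← intervalIntegral.integral_of_le pi_pos.le,
    integral_upper_half_circle (continuousOn_kmPullback hq hg) (kmPullback_inv q g), ← mul_assoc,
    inv_mul_cancel₀ (by exact_mod_cast pi_ne_zero), one_mul]

/-- The cases `r = 0` and `r = 1` of the formula `eval_chebyshevX_joukowski`. -/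
theorem kmFactor_add_inv {q : ℕ} (hq : 1 ≤ q) {t : ℂ} (ht : ‖t‖ = 1) :
    (1 + (q : ℂ)⁻¹) * (kmFactor q t * kmFactor q t⁻¹) = kmFactor q t + kmFactor q t⁻¹ ∧
    (t + t⁻¹) * (kmFactor q t * kmFactor q t⁻¹) = t * kmFactor q t + t⁻¹ * kmFactor q t⁻¹ := by
  by_cases h1 : q = 1
  · subst h1
    simp [kmFactor]
  have ht0 : t ≠ 0 := norm_pos_iff.1 (by rw [ht]; norm_num)
  have hq0 : (q : ℂ) ≠ 0 := by exact_mod_cast (by lia : q ≠ 0)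
  have hd1 := one_sub_inv_mul_sq_ne_zero hq h1 ht.le
  have hd2 := one_sub_inv_mul_sq_ne_zero hq h1 (t := t⁻¹) (by rw [norm_inv, ht, inv_one])
  have hinv : t * t⁻¹ = 1 := mul_inv_cancel₀ ht0
  rw [kmFactor, kmFactor, if_neg h1, if_neg h1, div_mul_div_comm]
  generalize (q : ℂ)⁻¹ = p at *
  generalize t⁻¹ = w at *
  constructor
  · rw [div_add_div _ _ hd1 hd2, mul_div_assoc']
    congr 1
    linear_combination (1 - p) * (t * w + 1) * hinv
  · rw [mul_div_assoc', mul_div_assoc', mul_div_assoc', div_add_div _ _ hd1 hd2]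
    congr 1
    linear_combination (1 - p) * (t * w ^ 2 + t ^ 2 * w) * hinv

/-- The values of `X_{r,q}` for `r ≥ 1` on the unit circle in the Joukowski variable. For `r = 0`
the right hand side is that of `1 + q⁻¹` instead of `X_{0,q} = 1`, see `kmFactor_add_inv`; this is
why the coefficient of `h` at `r = 0` is `∫ h dμ_q` and those at `r ≥ 1` carry the factor
`(1 + q⁻¹)⁻¹`. -/
theorem eval_chebyshevX_joukowski {q : ℕ} (hq : 1 ≤ q) {t : ℂ} (ht : ‖t‖ = 1) (r : ℕ) :
    ((chebyshevX (r + 1) q).map (algebraMap ℝ ℂ)).eval (joukowski t)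
        * (kmFactor q t * kmFactor q t⁻¹)
      = t ^ (r + 1) * kmFactor q t + t⁻¹ ^ (r + 1) * kmFactor q t⁻¹ := by
  have ht0 : t ≠ 0 := norm_pos_iff.1 (by rw [ht]; norm_num)
  have hinv : t * t⁻¹ = 1 := mul_inv_cancel₀ ht0
  obtain ⟨h0, h1⟩ := kmFactor_add_inv hq ht
  unfold joukowski
  induction r using Nat.twoStepInduction with
  | zero => simpa [chebyshevX_one] using h1
  | one =>
    rw [one_add_one_eq_two]
    simp only [chebyshevX_two, Polynomial.map_sub, Polynomial.map_pow, Polynomial.map_X,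
      Polynomial.map_one, Polynomial.map_C, Polynomial.eval_sub, Polynomial.eval_pow,
      Polynomial.eval_X, Polynomial.eval_one, Polynomial.eval_C, map_inv₀, map_natCast]
    linear_combination (t + t⁻¹) * h1 - h0 + (kmFactor q t + kmFactor q t⁻¹) * hinv
  | more r ih1 ih2 =>
    simp only [chebyshevX_add_three, Polynomial.map_sub, Polynomial.map_mul, Polynomial.map_X,
      Polynomial.eval_sub, Polynomial.eval_mul, Polynomial.eval_X]
    linear_combination (t + t⁻¹) * ih2 - ih1
      + (t ^ (r + 1) * kmFactor q t + t⁻¹ ^ (r + 1) * kmFactor q t⁻¹) * hinv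

/-- Averaging a function over `t ↦ t⁻¹` does not change its mean on the unit circle. -/
theorem circleAverage_half_add {F : ℂ → ℂ} (hF : ContinuousOn F (sphere 0 1))
    (hF' : ContinuousOn (fun t => F t⁻¹) (sphere 0 1)) :
    circleAverage (fun t => 2⁻¹ * (F t + F t⁻¹)) 0 1 = circleAverage F 0 1 := by
  have h1 := circleAverage_fun_smul (a := (2 : ℂ)⁻¹) (f := fun t => F t + F t⁻¹) (c := 0) (R := 1)
  simp only [smul_eq_mul] at h1
  rw [h1, circleAverage_fun_add (hF.circleIntegrable zero_le_one)
    (hF'.circleIntegrable zero_le_one), circleAverage_zero_one_congr_inv]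
  ring

theorem continuousOn_contour_integrand {q : ℕ} (hq : 1 ≤ q) {h : ℂ → ℂ}
    (hh : ContinuousOn (fun t => h (joukowski t)) (sphere 0 1)) (r : ℕ) :
    ContinuousOn (fun t => h (joukowski t) * kmFactor q t * t ^ r) (sphere 0 1) := by
  refine (hh.mul fun t ht => ?_).mul (by fun_prop)
  exact (differentiableAt_kmFactor hq
    (mem_sphere_zero_iff_norm.1 ht).le).continuousAt.continuousWithinAt

theorem continuousOn_comp_inv_sphere {F : ℂ → ℂ} (hF : ContinuousOn F (sphere 0 1)) :
    ContinuousOn (fun t => F t⁻¹) (sphere 0 1) := by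
  refine hF.comp (fun t ht => ?_) fun t ht => ?_
  · exact (continuousAt_inv₀ (norm_pos_iff.1
      (by rw [mem_sphere_zero_iff_norm.1 ht]; norm_num))).continuousWithinAt
  · rw [mem_sphere_zero_iff_norm, norm_inv, mem_sphere_zero_iff_norm.1 ht, inv_one]

theorem one_add_inv_natCast_ne_zero (q : ℕ) : 1 + (q : ℂ)⁻¹ ≠ 0 := by
  have h : 0 < 1 + (q : ℝ)⁻¹ := by positivity
  rw [show (1 : ℂ) + (q : ℂ)⁻¹ = ((1 + (q : ℝ)⁻¹ : ℝ) : ℂ) by push_cast; rfl]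
  exact ofReal_ne_zero.2 h.ne'

theorem integrable_mul_chebyshevX {q : ℕ} (hq : 1 ≤ q) {ρ : ℝ} (hρ : 1 < ρ) {h : ℂ → ℂ}
    (hh : DifferentiableOn ℂ h (ellipseInterior ρ)) (r : ℕ) :
    MeasureTheory.Integrable (fun x : ℝ => h (x : ℂ) * (((chebyshevX r q).eval x : ℝ) : ℂ))
      (kestenMcKay q) := by
  have h1 := integrable_kestenMcKay hq
    (g := fun z => h z * ((chebyshevX r q).map (algebraMap ℝ ℂ)).eval z)
    (continuousOn_comp_joukowski hρ (hh.mul (Polynomial.differentiable _).differentiableOn))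
  simpa only [eval_map_ofReal] using h1

/-- On the unit circle `X_{r,q}(J(t))` times the weight of `μ_q` is the sum of `t^r * kmFactor q t`
and its image under `t ↦ t⁻¹`, which contribute equally. -/
theorem chebyshevCoeff_eq_contourCoeff {q : ℕ} (hq : 1 ≤ q) {h : ℂ → ℂ}
    (hh : ContinuousOn (fun t => h (joukowski t)) (sphere 0 1)) (r : ℕ) :
    chebyshevCoeff (r + 1) q h = contourCoeff q h 1 (r + 1) := by
  have hP : ContinuousOn (fun t => ((chebyshevX (r + 1) q).map (algebraMap ℝ ℂ)).eval
      (joukowski t)) (sphere 0 1) :=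
    (Polynomial.continuous _).comp_continuousOn
      (continuousOn_id.add (continuousOn_comp_inv_sphere continuousOn_id))
  rw [chebyshevCoeff, kestenMcKay_restrict]
  simp only [← eval_map_ofReal]
  rw [integral_kestenMcKay_eq_circleAverage hq (g := fun z => h z *
      ((chebyshevX (r + 1) q).map (algebraMap ℝ ℂ)).eval z) (hh.mul hP), ← smul_eq_mul,
    ← circleAverage_smul]
  have hF := continuousOn_contour_integrand hq hh (r + 1)
  rw [contourCoeff, ← circleAverage_half_add hF (continuousOn_comp_inv_sphere hF)]
  refine circleAverage_congr_sphere fun t ht => ?_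
  rw [abs_one, mem_sphere_zero_iff_norm] at ht
  have key := eval_chebyshevX_joukowski hq ht r
  have hne := inv_mul_cancel₀ (one_add_inv_natCast_ne_zero q)
  simp only [Pi.smul_apply, smul_eq_mul, kmPullback, joukowski_inv]
  linear_combination h (joukowski t) / 2 * key + kmFactor q t * kmFactor q t⁻¹ * h (joukowski t) *
    ((chebyshevX (r + 1) q).map (algebraMap ℝ ℂ)).eval (joukowski t) / 2 * hne

theorem integral_eq_contourCoeff {q : ℕ} (hq : 1 ≤ q) {h : ℂ → ℂ}
    (hh : ContinuousOn (fun t => h (joukowski t)) (sphere 0 1)) :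
    ∫ x : ℝ, h x ∂(kestenMcKay q) = contourCoeff q h 1 0 := by
  rw [integral_kestenMcKay_eq_circleAverage hq hh]
  have hF := continuousOn_contour_integrand hq hh 0
  rw [contourCoeff, ← circleAverage_half_add hF (continuousOn_comp_inv_sphere hF)]
  refine circleAverage_congr_sphere fun t ht => ?_
  rw [abs_one, mem_sphere_zero_iff_norm] at ht
  obtain ⟨key, -⟩ := kmFactor_add_inv hq ht
  simp only [kmPullback, joukowski_inv, pow_zero, mul_one]
  linear_combination h (joukowski t) / 2 * key

end KestenMcKay

/-! ### Operators on `ℓ²(V)` and their matrices -/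

section Graphs

open Polynomial

theorem opOfMatrix_eq {V : Type*} {T : L2 V →L[ℂ] L2 V} {M : V → V → ℕ} (h : HasMatrix T M) :
    opOfMatrix M = T := by
  have hex : ∃ T : L2 V →L[ℂ] L2 V, HasMatrix T M := ⟨T, h⟩
  rw [opOfMatrix, dif_pos hex]
  exact hex.choose_spec.unique h

open Classical in
theorem indicatorL2_apply {V : Type*} (v w : V) :
    indicatorL2 v w = if w = v then 1 else 0 := by
  rw [indicatorL2, lp.single_apply, Pi.single_apply]

theorem inner_indicatorL2_left {V : Type*} (v : V) (f : L2 V) :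
    inner ℂ (indicatorL2 v) f = f v := by
  classical
  rw [indicatorL2, lp.inner_single_left]
  simp

theorem inner_indicatorL2_right {V : Type*} (v : V) (f : L2 V) :
    inner ℂ f (indicatorL2 v) = star (f v) := by
  rw [← inner_conj_symm, inner_indicatorL2_left]
  rfl

/-! ### Pullback along maps with fibres of constant size -/

theorem hasSum_comp_of_card_fiber {V D : Type*} {p : D → V} {d : ℕ} (hd : d ≠ 0)
    (hp : ∀ v, Nat.card {e // p e = v} = d) {g : V → ℝ} {a : ℝ} (hg0 : ∀ v, 0 ≤ g v)
    (hg : HasSum g a) : HasSum (fun e => g (p e)) (d * a) := by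
  have hfin : ∀ v, Finite {e // p e = v} := fun v =>
    Nat.finite_of_card_ne_zero (by rw [hp]; exact hd)
  have hfib : ∀ v, HasSum (fun e : {e // p e = v} => g (p e)) (d * g v) := by
    intro v
    have := Fintype.ofFinite {e // p e = v}
    have h1 : ∑ e : {e // p e = v}, g (p e) = d * g v := by
      have h2 : ∀ e : {e // p e = v}, g (p e) = g v := fun e => by rw [e.2]
      simp only [h2]
      rw [Finset.sum_const, Finset.card_univ, ← Nat.card_eq_fintype_card, hp, nsmul_eq_mul]
    exact h1 ▸ hasSum_fintype _
  rw [← (Equiv.sigmaFiberEquiv p).hasSum_iff]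
  have hs : Summable ((fun e => g (p e)) ∘ Equiv.sigmaFiberEquiv p) := by
    refine (summable_sigma_of_nonneg fun x => hg0 _).2 ⟨fun v => (hfib v).summable, ?_⟩
    refine (hg.summable.mul_left (d : ℝ)).congr fun v => ?_
    exact (hfib v).tsum_eq.symm
  exact HasSum.sigma_of_hasSum (hg.mul_left (d : ℝ)) hfib hs

theorem hasSum_sq_comp_of_card_fiber {V D : Type*} {p : D → V} {d : ℕ} (hd : d ≠ 0)
    (hp : ∀ v, Nat.card {e // p e = v} = d) (f : L2 V) :
    HasSum (fun e => ‖f (p e)‖ ^ (2 : ENNReal).toReal) (d * ‖f‖ ^ (2 : ENNReal).toReal) :=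
  hasSum_comp_of_card_fiber hd hp (fun v => by positivity) (lp.hasSum_norm (by norm_num) f)

/-- The pullback `f ↦ f ∘ p` from `ℓ²(V)` to `ℓ²(D)` as a linear map, for a map `p : D → V` all of
whose fibres have `d` elements. -/
def pullbackLinearMap {V D : Type*} (p : D → V) {d : ℕ} (hd : d ≠ 0)
    (hp : ∀ v, Nat.card {e // p e = v} = d) : L2 V →ₗ[ℂ] L2 D where
  toFun f := ⟨fun e => f (p e), memℓp_gen (hasSum_sq_comp_of_card_fiber hd hp f).summable⟩
  map_add' f g := by ext e; rfl
  map_smul' c f := by ext e; rfl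

theorem norm_pullbackLinearMap_le {V D : Type*} {p : D → V} {d : ℕ} (hd : d ≠ 0)
    (hp : ∀ v, Nat.card {e // p e = v} = d) (f : L2 V) :
    ‖pullbackLinearMap p hd hp f‖ ≤ √d * ‖f‖ := by
  have h1 : ‖pullbackLinearMap p hd hp f‖ ^ (2 : ENNReal).toReal
      = d * ‖f‖ ^ (2 : ENNReal).toReal :=
    (lp.hasSum_norm (by norm_num) _).unique (hasSum_sq_comp_of_card_fiber hd hp f)
  norm_num at h1
  refine le_of_eq ((pow_left_inj₀ (norm_nonneg _) (by positivity) two_ne_zero).1 ?_)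
  rw [h1, mul_pow, Real.sq_sqrt (Nat.cast_nonneg d)]

/-- The bounded operator `f ↦ f ∘ p` from `ℓ²(V)` to `ℓ²(D)`, for a map `p : D → V` all of whose
fibres have `d` elements. -/
noncomputable def pullbackL2 {V D : Type*} (p : D → V) {d : ℕ} (hd : d ≠ 0)
    (hp : ∀ v, Nat.card {e // p e = v} = d) : L2 V →L[ℂ] L2 D :=
  (pullbackLinearMap p hd hp).mkContinuous (√d) (norm_pullbackLinearMap_le hd hp)

theorem norm_pullbackL2_le {V D : Type*} {p : D → V} {d : ℕ} (hd : d ≠ 0)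
    (hp : ∀ v, Nat.card {e // p e = v} = d) : ‖pullbackL2 p hd hp‖ ≤ √d :=
  LinearMap.mkContinuous_norm_le _ (Real.sqrt_nonneg _) (norm_pullbackLinearMap_le hd hp)

namespace MultiGraph

variable {V D : Type*} {G : MultiGraph V D} {q : ℕ}

/-! ### Counting non-backtracking walks -/

theorem tgt_inv (G : MultiGraph V D) (e : D) : G.tgt (G.inv e) = G.org e := by
  rw [← G.org_inv, G.inv_inv]

theorem card_tgt_fiber (hG : G.IsRegular (q + 1)) (v : V) :
    Nat.card {e // G.tgt e = v} = q + 1 := by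
  rw [← hG v]
  refine Nat.card_congr ⟨fun e => ⟨G.inv e, by rw [G.org_inv, e.2]⟩,
    fun e => ⟨G.inv e, by rw [G.tgt_inv, e.2]⟩, fun e => ?_, fun e => ?_⟩ <;>
  simp [G.inv_inv]

open Classical in
/-- The directed edges with origin `a`, as a finite set (and `∅` if there are infinitely many). -/
noncomputable def outEdges (G : MultiGraph V D) (a : V) : Finset D :=
  if h : {e | G.org e = a}.Finite then h.toFinset else ∅

theorem mem_outEdges (hG : G.IsRegular (q + 1)) {a : V} {e : D} :
    e ∈ G.outEdges a ↔ G.org e = a := by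
  have h : {e | G.org e = a}.Finite :=
    Nat.finite_of_card_ne_zero (α := {e // G.org e = a}) (by rw [hG a]; exact q.succ_ne_zero)
  rw [outEdges, dif_pos h]
  simp

theorem card_outEdges (hG : G.IsRegular (q + 1)) (a : V) : (G.outEdges a).card = q + 1 := by
  rw [← hG a]
  exact (Nat.subtype_card _ fun e => mem_outEdges hG).symm

open Classical in
theorem adjEntry_eq (hG : G.IsRegular (q + 1)) (a b : V) :
    G.adjEntry a b = ∑ e ∈ G.outEdges a, if G.tgt e = b then 1 else 0 := by
  rw [Finset.sum_boole, Nat.cast_id]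
  exact Nat.subtype_card _ fun e => by rw [Finset.mem_filter, mem_outEdges hG]

theorem adjEntry_comm (G : MultiGraph V D) (a b : V) : G.adjEntry a b = G.adjEntry b a := by
  refine Nat.card_congr ⟨fun e => ⟨G.inv e, by rw [G.org_inv, e.2.2], by rw [G.tgt_inv, e.2.1]⟩,
    fun e => ⟨G.inv e, by rw [G.org_inv, e.2.2], by rw [G.tgt_inv, e.2.1]⟩,
    fun e => ?_, fun e => ?_⟩ <;>
  simp [G.inv_inv]

open Classical in
/-- The number of non-backtracking walks of length `r + 1` with first edge `e` that end in `b`. -/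
noncomputable def nbCount (G : MultiGraph V D) : ℕ → D → V → ℕ
  | 0, e, b => if G.tgt e = b then 1 else 0
  | r + 1, e, b => ∑ f ∈ (G.outEdges (G.tgt e)).erase (G.inv e), nbCount G r f b

/-- The sequence of edges `d` is a non-backtracking walk that ends in `b`. -/
def IsNBChain (G : MultiGraph V D) {r : ℕ} (d : Fin (r + 1) → D) (b : V) : Prop :=
  G.tgt (d (Fin.last r)) = b ∧
    ∀ i : Fin r, G.org (d i.succ) = G.tgt (d i.castSucc) ∧ d i.castSucc ≠ G.inv (d i.succ)

theorem isNBChain_cons {r : ℕ} {e : D} {d : Fin (r + 1) → D} {b : V} :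
    G.IsNBChain (Fin.cons e d : Fin (r + 2) → D) b ↔
      (G.org (d 0) = G.tgt e ∧ e ≠ G.inv (d 0)) ∧ G.IsNBChain d b := by
  rw [IsNBChain, IsNBChain, Fin.forall_fin_succ, ← Fin.succ_last, Fin.cons_succ]
  simp only [Fin.cons_succ, Fin.castSucc_zero, Fin.cons_zero, Fin.castSucc_succ]
  tauto

theorem _root_.card_subtype_mem_and {α β : Type*} (φ : α → β) (S : Finset β) (P : α → Prop)
    (hfin : ∀ f ∈ S, Finite {x // φ x = f ∧ P x}) :
    Finite {x // φ x ∈ S ∧ P x} ∧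
      Nat.card {x // φ x ∈ S ∧ P x} = ∑ f ∈ S, Nat.card {x // φ x = f ∧ P x} := by
  classical
  have hset : {x | φ x ∈ S ∧ P x} = ⋃ f ∈ S, {x | φ x = f ∧ P x} := by
    ext x; simp
  have hF : {x | φ x ∈ S ∧ P x}.Finite := by
    rw [hset]
    exact S.finite_toSet.biUnion fun f hf => hfin f hf
  refine ⟨hF, ?_⟩
  rw [Nat.subtype_card hF.toFinset (by simp),
    Finset.card_eq_sum_card_fiberwise (f := φ) (t := S) (fun x hx => by
      rw [Finset.mem_coe, Set.Finite.mem_toFinset] at hx; exact hx.1)]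
  refine Finset.sum_congr rfl fun f hf => (Nat.subtype_card _ fun x => ?_).symm
  simp only [Finset.mem_filter, Set.Finite.mem_toFinset, Set.mem_ofPred_eq]
  constructor
  · rintro ⟨⟨-, h⟩, h'⟩; exact ⟨h', h⟩
  · rintro ⟨h', h⟩; exact ⟨⟨h' ▸ hf, h⟩, h'⟩

theorem card_chains (hG : G.IsRegular (q + 1)) (b : V) (r : ℕ) (e : D) :
    Finite {d : Fin (r + 1) → D // d 0 = e ∧ G.IsNBChain d b} ∧
      Nat.card {d : Fin (r + 1) → D // d 0 = e ∧ G.IsNBChain d b} = G.nbCount r e b := by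
  classical
  induction r generalizing e with
  | zero =>
    have hsub : Subsingleton {d : Fin 1 → D // d 0 = e ∧ G.IsNBChain d b} := by
      refine ⟨fun d d' => Subtype.ext (funext fun i => ?_)⟩
      rw [Subsingleton.elim i 0, d.2.1, d'.2.1]
    refine ⟨inferInstance, ?_⟩
    rw [nbCount]
    split_ifs with h
    · exact Nat.card_eq_one_iff_unique.2 ⟨hsub, ⟨⟨fun _ => e, rfl, h, fun i => i.elim0⟩⟩⟩
    · have : IsEmpty {d : Fin 1 → D // d 0 = e ∧ G.IsNBChain d b} :=
        ⟨fun d => h (by rw [← d.2.1]; exact d.2.2.1)⟩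
      exact Nat.card_of_isEmpty
  | succ r ih =>
    obtain ⟨h1, h2⟩ := card_subtype_mem_and (fun d : Fin (r + 1) → D => d 0)
      ((G.outEdges (G.tgt e)).erase (G.inv e)) (fun d => G.IsNBChain d b) fun f _ => (ih f).1
    have hmem : ∀ f, f ∈ (G.outEdges (G.tgt e)).erase (G.inv e) ↔
        G.org f = G.tgt e ∧ e ≠ G.inv f := by
      intro f
      rw [Finset.mem_erase, mem_outEdges hG, and_comm]
      refine and_congr_right fun _ => not_congr ⟨?_, ?_⟩
      · rintro rfl; rw [G.inv_inv]
      · rintro rfl; rw [G.inv_inv]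
    have E : {d : Fin (r + 2) → D // d 0 = e ∧ G.IsNBChain d b} ≃
        {d : Fin (r + 1) → D //
          d 0 ∈ (G.outEdges (G.tgt e)).erase (G.inv e) ∧ G.IsNBChain d b} :=
      { toFun := fun d => ⟨Fin.tail d.1, by
          have h := d.2.2
          rw [← Fin.cons_self_tail d.1, isNBChain_cons, d.2.1, ← hmem] at h
          exact h⟩
        invFun := fun d => ⟨Fin.cons e d.1, rfl, isNBChain_cons.2 ⟨(hmem _).1 d.2.1, d.2.2⟩⟩
        left_inv := fun d => Subtype.ext (by
          have h := Fin.cons_self_tail d.1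
          rw [d.2.1] at h
          exact h)
        right_inv := fun d => rfl }
    refine ⟨Finite.of_equiv _ E.symm, ?_⟩
    rw [Nat.card_congr E, h2, nbCount]
    exact Finset.sum_congr rfl fun f _ => (ih f).2

/-- A non-backtracking walk of positive length is determined by its edges. -/
def nbWalkEquiv (G : MultiGraph V D) (r : ℕ) (a b : V) : G.NBWalk (r + 1) a b ≃
    {d : Fin (r + 1) → D // G.org (d 0) = a ∧ G.IsNBChain d b} where
  toFun w := ⟨w.edge, by rw [w.org_edge]; exact w.vert_zero,
    by rw [w.tgt_edge, Fin.succ_last]; exact w.vert_last,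
    fun i => ⟨by rw [w.org_edge, w.tgt_edge, Fin.castSucc_succ],
      w.nonbacktracking _ _ (by simp)⟩⟩
  invFun d :=
    { vert := Fin.cons a fun i => G.tgt (d.1 i)
      edge := d.1
      org_edge := fun i => by
        cases i using Fin.cases with
        | zero => exact d.2.1
        | succ i => rw [← Fin.succ_castSucc, Fin.cons_succ, (d.2.2.2 i).1]
      tgt_edge := fun i => by rw [Fin.cons_succ]
      vert_zero := rfl
      vert_last := d.2.2.1
      nonbacktracking := fun i j hij => by
        cases j using Fin.cases with
        | zero => simp at hij
        | succ j =>
          have : i = j.castSucc := Fin.ext (by simpa using hij.symm)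
          rw [this]
          exact (d.2.2.2 j).2 }
  left_inv w := by
    refine NBWalk.ext (funext fun i => ?_) rfl
    cases i using Fin.cases with
    | zero => exact w.vert_zero.symm
    | succ i => exact w.tgt_edge i
  right_inv d := rfl

theorem nbEntry_succ (hG : G.IsRegular (q + 1)) (r : ℕ) (a b : V) :
    G.nbEntry (r + 1) a b = ∑ e ∈ G.outEdges a, G.nbCount r e b := by
  rw [nbEntry, Nat.card_congr (G.nbWalkEquiv r a b)]
  simp only [← mem_outEdges hG]
  rw [(card_subtype_mem_and (fun d : Fin (r + 1) → D => d 0) (G.outEdges a)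
    (fun d => G.IsNBChain d b) fun f _ => (card_chains hG b r f).1).2]
  exact Finset.sum_congr rfl fun f _ => (card_chains hG b r f).2

open Classical in
theorem nbEntry_zero (G : MultiGraph V D) (a b : V) :
    G.nbEntry 0 a b = if a = b then 1 else 0 := by
  have hsub : Subsingleton (G.NBWalk 0 a b) := by
    refine ⟨fun w w' => NBWalk.ext (funext fun i => ?_) (funext fun i => i.elim0)⟩
    rw [Subsingleton.elim (α := Fin 1) i 0, w.vert_zero, w'.vert_zero]
  rw [nbEntry]
  split_ifs with h
  · exact Nat.card_eq_one_iff_unique.2 ⟨hsub, ⟨⟨fun _ => a, fun i => i.elim0, fun i => i.elim0,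
      fun i => i.elim0, rfl, h, fun i => i.elim0⟩⟩⟩
  · have : IsEmpty (G.NBWalk 0 a b) := ⟨fun w => h (w.vert_zero.symm.trans w.vert_last)⟩
    exact Nat.card_of_isEmpty

theorem nbCount_succ_add (hG : G.IsRegular (q + 1)) (r : ℕ) (e : D) (b : V) :
    G.nbCount (r + 1) e b + G.nbCount r (G.inv e) b = G.nbEntry (r + 1) (G.tgt e) b := by
  classical
  rw [nbEntry_succ hG, nbCount]
  exact Finset.sum_erase_add _ _ ((mem_outEdges hG).2 (G.org_inv e))

theorem nbEntry_add_two (hG : G.IsRegular (q + 1)) (r : ℕ) (a b : V) :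
    G.nbEntry (r + 2) a b + ∑ e ∈ G.outEdges a, G.nbCount r (G.inv e) b
      = ∑ e ∈ G.outEdges a, G.nbEntry (r + 1) (G.tgt e) b := by
  rw [nbEntry_succ hG, ← Finset.sum_add_distrib]
  exact Finset.sum_congr rfl fun e _ => nbCount_succ_add hG r e b

theorem nbEntry_one (hG : G.IsRegular (q + 1)) (a b : V) :
    G.nbEntry 1 a b = ∑ e ∈ G.outEdges a, G.nbEntry 0 (G.tgt e) b := by
  classical
  rw [nbEntry_succ hG]
  exact Finset.sum_congr rfl fun e _ => (G.nbEntry_zero _ _).symm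

theorem nbEntry_two (hG : G.IsRegular (q + 1)) (a b : V) :
    G.nbEntry 2 a b + (q + 1) * G.nbEntry 0 a b
      = ∑ e ∈ G.outEdges a, G.nbEntry 1 (G.tgt e) b := by
  classical
  rw [← nbEntry_add_two hG 0 a b]
  congr 1
  rw [← card_outEdges hG a, ← smul_eq_mul, ← Finset.sum_const]
  refine Finset.sum_congr rfl fun e he => ?_
  rw [nbCount, G.tgt_inv, (mem_outEdges hG).1 he, nbEntry_zero]

/-- Extending a walk by an edge at its origin creates a non-backtracking walk, unless that edge
undoes the first step; the latter happens `q` times for each walk that is two steps shorter. -/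
theorem nbEntry_add_three (hG : G.IsRegular (q + 1)) (r : ℕ) (a b : V) :
    G.nbEntry (r + 3) a b + q * G.nbEntry (r + 1) a b
      = ∑ e ∈ G.outEdges a, G.nbEntry (r + 2) (G.tgt e) b := by
  rw [← nbEntry_add_two hG (r + 1) a b]
  congr 1
  have h : ∑ e ∈ G.outEdges a, G.nbCount (r + 1) (G.inv e) b + G.nbEntry (r + 1) a b
      = (q + 1) * G.nbEntry (r + 1) a b := by
    rw [← card_outEdges hG a, ← smul_eq_mul, ← Finset.sum_const, nbEntry_succ hG r,
      ← Finset.sum_add_distrib]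
    refine Finset.sum_congr rfl fun e he => ?_
    have := nbCount_succ_add hG r (G.inv e) b
    rwa [G.inv_inv, G.tgt_inv, (mem_outEdges hG).1 he, nbEntry_succ hG] at this
  linarith

/-! ### The adjacency operator -/

/-- The operator `f ↦ (a ↦ ∑ f (tgt e))`, the sum over the directed edges `e` with origin `a`, as
the composition of the pullback along `tgt` with the adjoint of the pullback along `org`. -/
noncomputable def edgeSumOp (hG : G.IsRegular (q + 1)) : L2 V →L[ℂ] L2 V :=
  (pullbackL2 G.org q.succ_ne_zero hG).adjoint ∘L
    pullbackL2 G.tgt q.succ_ne_zero (card_tgt_fiber hG)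

theorem edgeSumOp_apply (hG : G.IsRegular (q + 1)) (f : L2 V) (a : V) :
    edgeSumOp hG f a = ∑ e ∈ G.outEdges a, f (G.tgt e) := by
  classical
  have h : edgeSumOp hG f a = ∑' e, inner ℂ (indicatorL2 a (G.org e)) (f (G.tgt e)) := by
    rw [← inner_indicatorL2_left, edgeSumOp, ContinuousLinearMap.comp_apply,
      ContinuousLinearMap.adjoint_inner_right]
    exact lp.inner_eq_tsum _ _
  rw [h, tsum_eq_sum (s := G.outEdges a)]
  · refine Finset.sum_congr rfl fun e he => ?_
    rw [indicatorL2_apply, if_pos ((mem_outEdges hG).1 he)]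
    simp
  · intro e he
    rw [indicatorL2_apply, if_neg fun h => he ((mem_outEdges hG).2 h)]
    simp

theorem norm_edgeSumOp_le (hG : G.IsRegular (q + 1)) : ‖edgeSumOp hG‖ ≤ q + 1 := by
  refine (ContinuousLinearMap.opNorm_comp_le _ _).trans ?_
  rw [LinearIsometryEquiv.norm_map]
  refine (mul_le_mul (norm_pullbackL2_le _ _) (norm_pullbackL2_le _ _) (norm_nonneg _)
    (Real.sqrt_nonneg _)).trans ?_
  rw [Real.mul_self_sqrt (Nat.cast_nonneg _)]
  push_cast
  rfl

theorem hasMatrix_edgeSumOp (hG : G.IsRegular (q + 1)) : HasMatrix (edgeSumOp hG) G.adjEntry := by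
  classical
  intro a b
  rw [edgeSumOp_apply, adjEntry_eq hG, Nat.cast_sum]
  refine Finset.sum_congr rfl fun e _ => ?_
  rw [indicatorL2_apply]
  push_cast
  rfl

theorem adjOp_eq (hG : G.IsRegular (q + 1)) : G.adjOp = edgeSumOp hG :=
  opOfMatrix_eq (hasMatrix_edgeSumOp hG)

theorem isSelfAdjoint_adjOp (hG : G.IsRegular (q + 1)) : IsSelfAdjoint G.adjOp := by
  have hA : HasMatrix G.adjOp G.adjEntry := adjOp_eq hG ▸ hasMatrix_edgeSumOp hG
  refine HasMatrix.unique (fun a b => ?_) hA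
  rw [← inner_indicatorL2_left, ContinuousLinearMap.star_eq_adjoint,
    ContinuousLinearMap.adjoint_inner_right, inner_indicatorL2_right, hA b a, adjEntry_comm]
  simp

theorem normAdjOp_eq (G : MultiGraph V D) (q : ℕ) : G.normAdjOp q = ((√q : ℝ) : ℂ)⁻¹ • G.adjOp := by
  rw [normAdjOp, Real.rpow_neg (Nat.cast_nonneg q), ← Real.sqrt_eq_rpow, Complex.ofReal_inv]

theorem isSelfAdjoint_normAdjOp (hG : G.IsRegular (q + 1)) : IsSelfAdjoint (G.normAdjOp q) := by
  refine IsSelfAdjoint.smul ?_ (isSelfAdjoint_adjOp hG)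
  exact Complex.conj_ofReal _

theorem norm_normAdjOp_le (hq : 1 ≤ q) (hG : G.IsRegular (q + 1)) :
    ‖G.normAdjOp q‖ ≤ √q + (√q)⁻¹ := by
  have h0 : (0 : ℝ) < q := by exact_mod_cast hq
  rw [normAdjOp_eq, norm_smul, norm_inv, Complex.norm_real, Real.norm_of_nonneg (by positivity),
    adjOp_eq hG]
  have hs : 0 < √(q : ℝ) := Real.sqrt_pos.2 h0
  rw [inv_mul_le_iff₀ hs, mul_add, mul_inv_cancel₀ hs.ne', Real.mul_self_sqrt h0.le]
  exact norm_edgeSumOp_le hG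

theorem hasMatrix_edgeSumOp_mul_sub (hG : G.IsRegular (q + 1)) {T T' : L2 V →L[ℂ] L2 V}
    {M M' K : V → V → ℕ} (hT : HasMatrix T M) (hT' : HasMatrix T' M') (c : ℕ)
    (hK : ∀ a b, K a b + c * M' a b = ∑ e ∈ G.outEdges a, M (G.tgt e) b) :
    HasMatrix (edgeSumOp hG * T - (c : ℂ) • T') K := by
  intro a b
  have h1 : (edgeSumOp hG * T) (indicatorL2 b) a = (K a b : ℂ) + c * M' a b := by
    have h2 : ∀ e ∈ G.outEdges a, T (indicatorL2 b) (G.tgt e) = (M (G.tgt e) b : ℂ) :=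
      fun e _ => hT _ _
    refine (edgeSumOp_apply hG (T (indicatorL2 b)) a).trans ((Finset.sum_congr rfl h2).trans ?_)
    rw [← Nat.cast_sum, ← hK]
    push_cast
    rfl
  change (edgeSumOp hG * T) (indicatorL2 b) a - (c : ℂ) * T' (indicatorL2 b) a = _
  rw [h1, hT']
  ring

/-- The recursion `A_1 = A`, `A_2 = A A_1 - (q + 1)`, `A_{r+3} = A A_{r+2} - q A_{r+1}` determines
the non-backtracking operators. -/
theorem hasMatrix_of_recursion (hG : G.IsRegular (q + 1)) {B : ℕ → L2 V →L[ℂ] L2 V}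
    (b0 : B 0 = 1) (b1 : B 1 = edgeSumOp hG)
    (b2 : B 2 = edgeSumOp hG * B 1 - ((q + 1 : ℕ) : ℂ) • B 0)
    (b3 : ∀ r, B (r + 3) = edgeSumOp hG * B (r + 2) - (q : ℂ) • B (r + 1)) (r : ℕ) :
    HasMatrix (B r) (G.nbEntry r) := by
  classical
  have m0 : HasMatrix (B 0) (G.nbEntry 0) := by
    intro a b
    rw [b0, nbEntry_zero]
    simp [indicatorL2_apply]
  have m1 : HasMatrix (B 1) (G.nbEntry 1) := by
    have h := hasMatrix_edgeSumOp_mul_sub hG (K := G.nbEntry 1) m0 m0 0 fun a b => by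
      rw [nbEntry_one hG, zero_mul, add_zero]
    rwa [b0, mul_one, Nat.cast_zero, zero_smul, sub_zero, ← b1] at h
  have m2 : HasMatrix (B 2) (G.nbEntry 2) :=
    b2 ▸ hasMatrix_edgeSumOp_mul_sub hG m1 m0 (q + 1) (nbEntry_two hG)
  have key : ∀ r, HasMatrix (B (r + 1)) (G.nbEntry (r + 1)) ∧
      HasMatrix (B (r + 2)) (G.nbEntry (r + 2)) := by
    intro r
    induction r with
    | zero => exact ⟨m1, m2⟩
    | succ r ih =>
      exact ⟨ih.2, b3 r ▸ hasMatrix_edgeSumOp_mul_sub hG ih.2 ih.1 q (nbEntry_add_three hG r)⟩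
  cases r with
  | zero => exact m0
  | succ r => exact (key r).1

/-- `A_r = q^{r/2} X_{r,q}(q^{-1/2} A)`: both sides satisfy the same recursion. -/
theorem hasMatrix_aeval_chebyshevX (hq : 1 ≤ q) (hG : G.IsRegular (q + 1)) (r : ℕ) :
    HasMatrix (((√q : ℝ) : ℂ) ^ r •
      aeval (G.normAdjOp q) ((chebyshevX r q).map (algebraMap ℝ ℂ))) (G.nbEntry r) := by
  have h0 : (0 : ℝ) < q := by exact_mod_cast hq
  have hNA : edgeSumOp hG = ((√q : ℝ) : ℂ) • G.normAdjOp q := by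
    rw [normAdjOp_eq, smul_smul, mul_inv_cancel₀ (Complex.ofReal_ne_zero.2
      (Real.sqrt_pos.2 h0).ne'), one_smul, adjOp_eq hG]
  have hs2 : ((√q : ℝ) : ℂ) ^ 2 = q := by
    rw [← Complex.ofReal_pow, Real.sq_sqrt h0.le, Complex.ofReal_natCast]
  have hqC : (q : ℂ) ≠ 0 := by exact_mod_cast h0.ne'
  generalize ((√q : ℝ) : ℂ) = s at hNA hs2
  generalize G.normAdjOp q = N at hNA
  refine hasMatrix_of_recursion hG (B := fun r =>
    s ^ r • aeval N ((chebyshevX r q).map (algebraMap ℝ ℂ))) ?_ ?_ ?_ (fun r => ?_) r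
  · simp [chebyshevX_zero]
  · simp [chebyshevX_one, hNA]
  · simp only [chebyshevX_zero, chebyshevX_one, chebyshevX_two, Polynomial.map_sub,
      Polynomial.map_pow, Polynomial.map_X, Polynomial.map_one, Polynomial.map_C, map_sub, map_pow,
      aeval_X, map_one, aeval_C, map_inv₀, map_natCast, pow_zero, pow_one, one_smul]
    rw [hNA, smul_mul_smul_comm, ← pow_two, ← pow_two, Algebra.algebraMap_eq_smul_one, smul_sub,
      smul_sub, smul_smul, hs2, mul_inv_cancel₀ hqC, Nat.cast_add, add_smul, Nat.cast_one, sub_sub]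
  · simp only [chebyshevX_add_three, Polynomial.map_sub, Polynomial.map_mul, Polynomial.map_X,
      map_sub, map_mul, aeval_X]
    rw [hNA, smul_mul_smul_comm, smul_smul, smul_sub, ← hs2]
    congr 2 <;> ring

theorem nbOp_eq (hq : 1 ≤ q) (hG : G.IsRegular (q + 1)) (r : ℕ) :
    G.nbOp r = ((√q : ℝ) : ℂ) ^ r •
      aeval (G.normAdjOp q) ((chebyshevX r q).map (algebraMap ℝ ℂ)) :=
  opOfMatrix_eq (hasMatrix_aeval_chebyshevX hq hG r)

end MultiGraph

end Graphs

/-! ### Functional calculus of the normalized adjacency operator -/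

namespace MultiGraph

open Polynomial

variable {V D : Type*} {G : MultiGraph V D} {q : ℕ}

theorem exists_real_of_mem_spectrum (hq : 1 ≤ q) (hG : G.IsRegular (q + 1)) {z : ℂ}
    (hz : z ∈ spectrum ℂ (G.normAdjOp q)) : ∃ x : ℝ, z = x ∧ |x| ≤ √q + (√q)⁻¹ := by
  have h1 := (isSelfAdjoint_normAdjOp hG).mem_spectrum_eq_re hz
  have h2 : ‖z‖ ≤ ‖G.normAdjOp q‖ * ‖(1 : L2 V →L[ℂ] L2 V)‖ := by
    simpa using spectrum.subset_closedBall_norm_mul (G.normAdjOp q) hz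
  have h3 : ‖(1 : L2 V →L[ℂ] L2 V)‖ ≤ 1 := ContinuousLinearMap.norm_id_le
  refine ⟨z.re, h1, ?_⟩
  rw [h1, Complex.norm_real] at h2
  calc |z.re| ≤ ‖G.normAdjOp q‖ * ‖(1 : L2 V →L[ℂ] L2 V)‖ := h2
    _ ≤ ‖G.normAdjOp q‖ * 1 := by gcongr
    _ ≤ √q + (√q)⁻¹ := by rw [mul_one]; exact norm_normAdjOp_le hq hG

theorem spectrum_normAdjOp_subset (hq : 1 ≤ q) (hG : G.IsRegular (q + 1)) {ρ : ℝ}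
    (hρ : √q < ρ) : spectrum ℂ (G.normAdjOp q) ⊆ ellipseInterior ρ := by
  intro z hz
  obtain ⟨x, rfl, hx⟩ := exists_real_of_mem_spectrum hq hG hz
  exact ofReal_mem_ellipseInterior (one_le_sqrt_natCast hq) hρ hx

/-- The expansion of `h` in the polynomials `X_{r,q}` converges uniformly on the spectrum of the
normalized adjacency operator, hence in operator norm after applying the functional calculus. -/
theorem hasSum_cfc_normAdjOp (hq : 1 ≤ q) (hG : G.IsRegular (q + 1)) {ρ : ℝ}
    (hρ : √q < ρ) {h : ℂ → ℂ} (hh : DifferentiableOn ℂ h (ellipseInterior ρ)) :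
    HasSum (fun r => contourCoeff q h 1 r •
      aeval (G.normAdjOp q) ((chebyshevX r q).map (algebraMap ℝ ℂ)))
      (cfc h (G.normAdjOp q)) := by
  have hs := one_le_sqrt_natCast hq
  have hρ1 : 1 < ρ := hs.trans_lt hρ
  have hs0 : 0 < √(q : ℝ) := by linarith
  -- an admissible radius, which exists because `√q < ρ`
  obtain ⟨τ, hρτ, hτs⟩ := exists_between ((inv_lt_inv₀ (by linarith) hs0).2 hρ)
  have hτ0 : 0 < τ := (inv_pos.2 (by linarith)).trans hρτ
  have hsτ : √q * τ < 1 := by rwa [mul_comm, ← lt_inv_mul_iff₀' hs0, mul_one]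
  have hτ1 : τ ≤ 1 := by nlinarith
  have hc : ∀ r, contourCoeff q h τ r = contourCoeff q h 1 r :=
    contourCoeff_eq_one hq hρ1 hh hρτ hτ1
  obtain ⟨B, hB⟩ := exists_norm_contourCoeff_le hq hρ1 hh hρτ hτ1
  simp only [hc] at hB
  have hu : Summable fun r : ℕ => B * ((2 * (r : ℝ) + 1) * (√q * τ) ^ r) :=
    (summable_linear_mul_pow (by positivity) hsτ).mul_left B
  have hunif := (tendstoUniformlyOn_tsum (s := spectrum ℂ (G.normAdjOp q))
    (f := fun r z => contourCoeff q h 1 r * ((chebyshevX r q).map (algebraMap ℝ ℂ)).eval z) hu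
    (fun r z hz => by
      obtain ⟨x, rfl, hx⟩ := exists_real_of_mem_spectrum hq hG hz
      rw [eval_map_ofReal, norm_mul, Complex.norm_real]
      have h1 := abs_eval_chebyshevX_le hq hs hx r
      calc ‖contourCoeff q h 1 r‖ * ‖(chebyshevX r q).eval x‖
          ≤ (B * τ ^ r) * ((2 * r + 1) * √q ^ r) :=
            mul_le_mul (hB r) h1 (norm_nonneg _) ((norm_nonneg _).trans (hB r))
        _ = _ := by rw [mul_pow]; ring)).congr_right (g := h) (fun z hz => by
      obtain ⟨x, rfl, hx⟩ := exists_real_of_mem_spectrum hq hG hz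
      have h1 := hasSum_contourCoeff_mul_chebyshevX hq hs hsτ hρτ hρ1 hh hx
        (ofReal_mem_ellipseInterior hs hρ hx)
      simp only [hc] at h1
      simp only [eval_map_ofReal]
      exact h1.tsum_eq)
  have hlim := tendsto_cfc_fun (a := G.normAdjOp q) hunif
    (Filter.Eventually.of_forall fun t => by fun_prop)
  have hN : IsStarNormal (G.normAdjOp q) := (isSelfAdjoint_normAdjOp hG).isStarNormal
  refine hlim.congr fun t => ?_
  have h2 : (fun z => ∑ r ∈ t, contourCoeff q h 1 r *
      ((chebyshevX r q).map (algebraMap ℝ ℂ)).eval z)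
      = (∑ r ∈ t, contourCoeff q h 1 r • (chebyshevX r q).map (algebraMap ℝ ℂ)).eval := by
    funext z
    simp [eval_finsetSum]
  rw [h2, cfc_polynomial _ _ hN, map_sum]
  simp only [map_smul]

/-- The terms of index at least `1` of the expansion, by the non-backtracking operators. -/
theorem contourCoeff_smul_aeval_eq (hq : 1 ≤ q) (hG : G.IsRegular (q + 1)) {ρ : ℝ}
    (hρ : 1 < ρ) {h : ℂ → ℂ} (hh : DifferentiableOn ℂ h (ellipseInterior ρ)) (r : ℕ) :
    contourCoeff q h 1 (r + 1) •
        aeval (G.normAdjOp q) ((chebyshevX (r + 1) q).map (algebraMap ℝ ℂ))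
      = ((((q : ℝ) ^ (-((r + 1 : ℕ) : ℝ) / 2) : ℝ) : ℂ) * chebyshevCoeff (r + 1) q h) •
        G.nbOp (r + 1) := by
  have hs0 : 0 < √(q : ℝ) := zero_lt_one.trans_le (one_le_sqrt_natCast hq)
  have hpow : (q : ℝ) ^ (-((r + 1 : ℕ) : ℝ) / 2) = (√q ^ (r + 1))⁻¹ := by
    rw [← Real.rpow_natCast, Real.sqrt_eq_rpow, ← Real.rpow_mul (Nat.cast_nonneg q),
      ← Real.rpow_neg (Nat.cast_nonneg q)]
    congr 1
    ring
  have hne : ((√(q : ℝ) : ℝ) : ℂ) ^ (r + 1) ≠ 0 := pow_ne_zero _ (Complex.ofReal_ne_zero.2 hs0.ne')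
  rw [nbOp_eq hq hG, smul_smul,
    chebyshevCoeff_eq_contourCoeff hq (continuousOn_comp_joukowski hρ hh), hpow, Complex.ofReal_inv,
    Complex.ofReal_pow]
  congr 1
  field_simp

/-- On a tree all `A_r` with `r ≥ 1` have zero diagonal, so that the expansion of a polynomial in
the operators `A_r` has `∫ P dμ_q` as its diagonal entries. -/
theorem isSpectralMeasure_of_isTree (hq : 1 ≤ q) (hT : G.IsTree) (hG : G.IsRegular (q + 1))
    (o : V) : IsSpectralMeasure (G.normAdjOp q) (indicatorL2 o) (kestenMcKay q) := by
  have hs := one_le_sqrt_natCast hq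
  have hρ : √(q : ℝ) < √q + 1 := by linarith
  have hρ1 : 1 < √(q : ℝ) + 1 := hs.trans_lt hρ
  have hN : IsStarNormal (G.normAdjOp q) := (isSelfAdjoint_normAdjOp hG).isStarNormal
  have hoo : indicatorL2 o o = 1 := by rw [indicatorL2_apply, if_pos rfl]
  have hdiag : ∀ r, aeval (G.normAdjOp q) ((chebyshevX (r + 1) q).map (algebraMap ℝ ℂ))
      (indicatorL2 o) o = 0 := by
    intro r
    have h1 := hasMatrix_aeval_chebyshevX hq hG (r + 1) o o
    have := hT.acyclic (r + 1) o (by lia)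
    rw [nbEntry, Nat.card_of_isEmpty, Nat.cast_zero] at h1
    exact (mul_eq_zero.1 h1).resolve_left
      (pow_ne_zero _ (Complex.ofReal_ne_zero.2 (by linarith)))
  have main : ∀ P : ℝ[X], MeasureTheory.Integrable (fun x => P.eval x) (kestenMcKay q) ∧
      ((∫ x, P.eval x ∂(kestenMcKay q) : ℝ) : ℂ) = inner ℂ (indicatorL2 o)
        (aeval (G.normAdjOp q) (P.map (algebraMap ℝ ℂ)) (indicatorL2 o)) := by
    intro P
    have hd : DifferentiableOn ℂ (P.map (algebraMap ℝ ℂ)).eval (ellipseInterior (√q + 1)) :=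
      (Polynomial.differentiable _).differentiableOn
    have hc := continuousOn_comp_joukowski hρ1 hd
    have hi := integrable_kestenMcKay hq (g := (P.map (algebraMap ℝ ℂ)).eval) hc
    have he := integral_eq_contourCoeff hq (h := (P.map (algebraMap ℝ ℂ)).eval) hc
    simp only [eval_map_ofReal] at hi he
    refine ⟨by simpa using hi.re, ?_⟩
    have hsum := (hasSum_cfc_normAdjOp hq hG hρ hd).mapL
      ((innerSL ℂ (indicatorL2 o)) ∘L ContinuousLinearMap.apply ℂ (L2 V) (indicatorL2 o))
    have h0 := hsum.unique (hasSum_single 0 fun r hr => by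
      obtain ⟨r, rfl⟩ := Nat.exists_eq_succ_of_ne_zero hr
      rw [map_smul]
      refine smul_eq_zero_of_right _ ?_
      exact (inner_indicatorL2_left _ _).trans (hdiag r))
    rw [cfc_polynomial _ _ hN] at h0
    rw [← integral_complex_ofReal, he]
    refine Eq.trans ?_ h0.symm
    rw [map_smul, chebyshevX_zero, Polynomial.map_one, map_one]
    have h1 : ((innerSL ℂ (indicatorL2 o)) ∘L ContinuousLinearMap.apply ℂ (L2 V) (indicatorL2 o))
        (1 : L2 V →L[ℂ] L2 V) = 1 := (inner_indicatorL2_left o (indicatorL2 o)).trans hoo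
    rw [h1, smul_eq_mul, mul_one]
  refine ⟨⟨?_⟩, main⟩
  have h1 := (main 1).2
  have h2 : inner ℂ (indicatorL2 o) (indicatorL2 o) = (1 : ℂ) :=
    (inner_indicatorL2_left _ _).trans hoo
  rw [Polynomial.map_one, map_one, one_apply_eq_self, h2] at h1
  simp only [eval_one, MeasureTheory.integral_const, smul_eq_mul, mul_one] at h1
  have h3 : (kestenMcKay q).real Set.univ = 1 := by exact_mod_cast h1
  rwa [MeasureTheory.measureReal_def, ENNReal.toReal_eq_one_iff] at h3

end MultiGraph

theorem theorem4p2 (q : ℕ) (hq : 1 ≤ q) :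
    -- `μ_q` is the normalized spectral measure of the `(q+1)`-regular tree
    (∀ (W : Type*) (F : Type*) (T : MultiGraph W F), T.IsTree → T.IsRegular (q + 1) →
      ∀ o : W, IsSpectralMeasure (T.normAdjOp q) (indicatorL2 o) (kestenMcKay q)) ∧
    ∀ (V : Type*) (D : Type*) (G : MultiGraph V D), G.IsRegular (q + 1) →
      -- `A` and the `A_r` are the bounded operators with the matrices that define them
      HasMatrix G.adjOp G.adjEntry ∧ IsSelfAdjoint G.adjOp ∧
      (∀ r : ℕ, HasMatrix (G.nbOp r) (G.nbEntry r)) ∧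
      ∀ (ρ : ℝ), (q : ℝ) ^ (1 / 2 : ℝ) < ρ →
        ∀ h : ℂ → ℂ, DifferentiableOn ℂ h (ellipseInterior ρ) →
          -- both sides of the formula are meaningful
          spectrum ℂ (G.normAdjOp q) ⊆ ellipseInterior ρ ∧
          MeasureTheory.Integrable (fun x : ℝ => h (x : ℂ)) (kestenMcKay q) ∧
          (∀ r : ℕ, MeasureTheory.Integrable
            (fun x : ℝ => h (x : ℂ) * (((chebyshevX r q).eval x : ℝ) : ℂ)) (kestenMcKay q)) ∧
          -- convergence in operator norm, and the formula
          Summable (fun r : ℕ => ((((q : ℝ) ^ (-((r + 1 : ℕ) : ℝ) / 2) : ℝ) : ℂ)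
            * chebyshevCoeff (r + 1) q h) • G.nbOp (r + 1)) ∧
          cfc h (G.normAdjOp q)
            = (∫ x : ℝ, h (x : ℂ) ∂(kestenMcKay q)) • (1 : L2 V →L[ℂ] L2 V)
              + ∑' r : ℕ, ((((q : ℝ) ^ (-((r + 1 : ℕ) : ℝ) / 2) : ℝ) : ℂ)
                * chebyshevCoeff (r + 1) q h) • G.nbOp (r + 1) := by

  refine ⟨fun W F T hT hreg o => MultiGraph.isSpectralMeasure_of_isTree hq hT hreg o,
    fun V D G hG => ⟨?_, MultiGraph.isSelfAdjoint_adjOp hG, fun r => ?_, fun ρ hρ h hh => ?_⟩⟩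
  · exact MultiGraph.adjOp_eq hG ▸ MultiGraph.hasMatrix_edgeSumOp hG
  · exact MultiGraph.nbOp_eq hq hG r ▸ MultiGraph.hasMatrix_aeval_chebyshevX hq hG r
  rw [← Real.sqrt_eq_rpow] at hρ
  have hρ1 : 1 < ρ := (one_le_sqrt_natCast hq).trans_lt hρ
  have hc := continuousOn_comp_joukowski hρ1 hh
  have hsum := MultiGraph.hasSum_cfc_normAdjOp hq hG hρ hh
  have hterm := MultiGraph.contourCoeff_smul_aeval_eq hq hG hρ1 hh
  have hs := (summable_nat_add_iff 1).2 hsum.summable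
  refine ⟨MultiGraph.spectrum_normAdjOp_subset hq hG hρ, integrable_kestenMcKay hq hc,
    integrable_mul_chebyshevX hq hρ1 hh, ?_, ?_⟩
  · simpa only [hterm] using hs
  · rw [← hsum.tsum_eq, hsum.summable.tsum_eq_zero_add, integral_eq_contourCoeff hq hc]
    simp only [hterm]
    rw [chebyshevX_zero, Polynomial.map_one, map_one]
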